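/- Let $\mathbb K\in\{\mathbb R,\mathbb C\}$ and let $N\ge 0$ be an integer. For a Lie algebra $\mathfrak g$ over $\mathbb K$ put $\mathfrak g^{(1)}=\mathfrak g$ and $\mathfrak g^{(j)}=[\mathfrak g,\mathfrak g^{(j-1)}]$ (linear span of brackets) for $j\ge 2$, and assume $\mathfrak g^{(N+1)}=\{0\}$ in what follows; this includes every $(N+1)$-step nilpotent Lie algebra, that is, one with $\mathfrak g^{(N)}\neq\{0\}=\mathfrak g^{(N+1)}$, where $N\ge1$. (1) Let $G$ be a connected and simply connected (smooth) Banach–Lie group over $\mathbb K$ whose Lie algebra $\mathfrak g$ satisfies $\mathfrak g^{(N+1)}=\{0\}$. Then there exist a Banach space $F$ over $\mathbb K$ and an injective group homomorphism $\rho$ from $G$ into the invertible bounded operators on $F$ that is continuous for the operator norm and satisfies $$(\rho(x)-\mathbf 1)^{2^{N-1}N+1}=0\quad\text{for all }x\in G.$$ (2) Let $\mathfrak g$ be a Banach–Lie algebra over $\mathbb K$ (a Banach space with a continuous Lie bracket) with $\mathfrak g^{(N+1)}=\{0\}$. Then there exist a Banach space $F$ over $\mathbb K$ and an injective bounded linear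 map $\rho\colon\mathfrak g\to\mathcal B(F)$ into the bounded operators on $F$ with $\rho([x,y])=\rho(x)\rho(y)-\rho(y)\rho(x)$ for all $x,y\in\mathfrak g$ and $$\rho(x)^{2^{N-1}N+1}=0\quad\text{for all }x\in\mathfrak g.$$ (For $N=0$ the exponent $2^{N-1}N+1$ is $1$.) -/

import Mathlib

open scoped Manifold ContDiff

universe u v w

/-- A normed Lie ring: a Lie ring with a norm for which the bracket is bounded. -/
class NormedLieRing (L : Type*) extends NormedAddCommGroup L, LieRing L where
  exists_norm_lie_le : ∃ C : ℝ, ∀ x y : L, ‖⁅x, y⁆‖ ≤ C * ‖x‖ * ‖y‖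

/-- A normed Lie algebra over `𝕜`. Together with `[CompleteSpace L]` this is a Banach-Lie algebra:
a Banach space with a Lie algebra structure whose bracket is continuous. -/
class NormedLieAlgebra (𝕜 : Type*) (L : Type*) [NormedField 𝕜] [NormedLieRing L]
  extends NormedSpace 𝕜 L, LieAlgebra 𝕜 L

/-- Over `ℝ` and `ℂ` a smooth Lie group has the smoothness which Mathlib asks for in the
construction of the Lie bracket on its tangent space at the identity. -/
instance lieGroup_minSmoothness {𝕜 E G : Type*} [RCLike 𝕜] [NormedAddCommGroup E]
    [NormedSpace 𝕜 E] [TopologicalSpace G] [ChartedSpace E G] [Group G]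
    [LieGroup 𝓘(𝕜, E) ∞ G] :
    LieGroup 𝓘(𝕜, E) (minSmoothness 𝕜 3) G :=
  LieGroup.of_le (n := ∞) (by
    rw [minSmoothness_of_isRCLikeNormedField]
    exact ENat.LEInfty.out)

/-! Lie algebra. On the vector space of a nilpotent Lie algebra, `mcForm` is the left Maurer–Cartan
form of the exponential coordinates. Its inverse `frame` gives left-invariant fields X_a with [X_a,
X_b] = X_[a,b] (`lieBracket_frame`, from `maurerCartan`), so no Baker–Campbell–Hausdorff product is
needed. The Banach space F consists of sequences of bounded multilinear maps of degree at most N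
that respect the relation ab - ba = [a,b]: a truncated dual of the enveloping algebra, or jets at
the origin. Inserting -x in the first slot is a representation ρ, and it lowers the degree, so
ρ(x)^(N+1) = 0. The jet of the identity map, given by X_{x_1}...X_{x_k} id at 0, belongs to F
because words longer than N contribute nothing. Pairing with it gives a bounded linear `repLog` with
`repLog` (exp ρ(x)) = x, because the identity is affine along each line 𝕜x. Hence ρ is faithful.

Group. Let θ be the Maurer–Cartan form of G in a chart at 1. The equation dP = P ρ(θ) is strictly
triangular for the degree filtration of F, so finitely many uses of the Poincaré lemma solve it on a
ball (`NilpotentRep.exists_flat`). By left invariance of θ and uniqueness, P is a local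
homomorphism, and simple connectedness extends it to φ on G (`exists_monoidHom_of_local`).

Injectivity. The derivative of log at exp ρ(x) in left-translated directions is unipotent
(`repLog_exp_mul`), so log ∘ φ is injective near each g with φ(g) in exp ρ(L). A local inverse of
log ∘ φ is a local exponential map, repeated doubling makes it a global map E, and E ∘ log ∘ φ is
the identity on a clopen set, thus everywhere. So φ is injective and each φ(g) is some exp ρ(x),
whence (φ(g) - 1)^(N+1) = 0. The stated exponent is at least N + 1. -/

/-! ### Lower central series. -/

section LowerCentralSeries

variable {𝕜 L : Type*} [CommRing 𝕜] [LieRing L] [LieAlgebra 𝕜 L]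

open LieModule in
/-- The lower central series is multiplicative for the bracket. -/
theorem lie_mem_lowerCentralSeries_add {i j : ℕ} {x y : L}
    (hx : x ∈ lowerCentralSeries 𝕜 L L i) (hy : y ∈ lowerCentralSeries 𝕜 L L j) :
    ⁅x, y⁆ ∈ lowerCentralSeries 𝕜 L L (i + j + 1) := by
  induction i generalizing j x y with
  | zero =>
    rw [zero_add, lowerCentralSeries_succ]
    exact LieSubmodule.lie_mem_lie (LieSubmodule.mem_top x) hy
  | succ i ih =>
    rw [lowerCentralSeries_succ, ← LieSubmodule.mem_toSubmodule,
      LieSubmodule.lieIdeal_oper_eq_linear_span'] at hx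
    induction hx using Submodule.span_induction with
    | mem z hz =>
      obtain ⟨a, -, b, hb, rfl⟩ := hz
      -- By Jacobi [[a,b],y] = [a,[b,y]] - [b,[a,y]], and both terms fall under the induction
      -- hypothesis for b.
      rw [lie_lie]
      refine sub_mem ?_ ?_
      · have := ih hb hy
        have h2 : i + 1 + j + 1 = (i + j + 1) + 1 := by ring
        rw [h2, lowerCentralSeries_succ]
        exact LieSubmodule.lie_mem_lie (LieSubmodule.mem_top a) this
      · have h3 : ⁅a, y⁆ ∈ lowerCentralSeries 𝕜 L L (j + 1) := by
          rw [lowerCentralSeries_succ]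
          exact LieSubmodule.lie_mem_lie (LieSubmodule.mem_top a) hy
        have := ih hb h3
        have h2 : i + 1 + j + 1 = i + (j + 1) + 1 := by ring
        rwa [h2]
    | zero => simp
    | add a b _ _ ha hb => rw [add_lie]; exact add_mem ha hb
    | smul c a _ ha => rw [smul_lie]; exact Submodule.smul_mem _ c ha

end LowerCentralSeries

/-! ### The Maurer–Cartan form in exponential coordinates. -/

/-- A continuous Lie bracket on a normed space together with a filtration of length `N` which is
multiplicative for the bracket. -/
structure NilpotentBracket (𝕜 L : Type*) [RCLike 𝕜] [NormedAddCommGroup L] [NormedSpace 𝕜 L]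
    (N : ℕ) where
  /-- the bracket -/
  br : L →L[𝕜] L →L[𝕜] L
  skew : ∀ x y, br x y = -br y x
  leibniz : ∀ x y z, br x (br y z) = br (br x y) z + br y (br x z)
  /-- the filtration -/
  filt : ℕ → Submodule 𝕜 L
  filt_zero : filt 0 = ⊤
  filt_last : filt N = ⊥
  br_mem : ∀ {i j : ℕ} {x y : L}, x ∈ filt i → y ∈ filt j → br x y ∈ filt (i + j + 1)
  filt_anti : Antitone filt

namespace NilpotentBracket

noncomputable section

variable {𝕜 L : Type*} [RCLike 𝕜] [NormedAddCommGroup L] [NormedSpace 𝕜 L] {N : ℕ}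
  (B : NilpotentBracket 𝕜 L N)

theorem mem_filt_zero (x : L) : x ∈ B.filt 0 := by simp [B.filt_zero]

theorem eq_zero_of_mem_filt {j : ℕ} (hj : N ≤ j) {x : L} (hx : x ∈ B.filt j) : x = 0 := by
  have := B.filt_anti hj hx
  rwa [B.filt_last, Submodule.mem_bot] at this

theorem fderiv_br {f g : L → L} {y : L} (hf : DifferentiableAt 𝕜 f y)
    (hg : DifferentiableAt 𝕜 g y) (u : L) :
    fderiv 𝕜 (fun z => B.br (f z) (g z)) y u =
      B.br (fderiv 𝕜 f y u) (g y) + B.br (f y) (fderiv 𝕜 g y u) := by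
  have := (B.br.hasFDerivAt.comp y hf.hasFDerivAt).clm_apply hg.hasFDerivAt
  simp only [Function.comp_apply] at this
  rw [this.fderiv]
  simp [add_comm]

theorem contDiff_br {f g : L → L} {n : WithTop ℕ∞} (hf : ContDiff 𝕜 n f)
    (hg : ContDiff 𝕜 n g) : ContDiff 𝕜 n (fun z => B.br (f z) (g z)) :=
  (B.br.contDiff.comp hf).clm_apply hg

/-- Powers of `-ad y`. -/
def negAdPow (k : ℕ) (y : L) : L →L[𝕜] L := (-B.br y) ^ k

@[simp] theorem negAdPow_zero_apply (y v : L) : B.negAdPow 0 y v = v := rfl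

theorem negAdPow_succ_apply (k : ℕ) (y v : L) :
    B.negAdPow (k + 1) y v = -B.br y (B.negAdPow k y v) := by
  simp [negAdPow, pow_succ']

theorem contDiff_negAdPow (k : ℕ) {n : WithTop ℕ∞} : ContDiff 𝕜 n (B.negAdPow k) := by
  induction k with
  | zero => exact contDiff_const (c := (1 : L →L[𝕜] L))
  | succ k ih =>
    have : B.negAdPow (k + 1) = fun y => (-B.br y) ∘L B.negAdPow k y := by
      ext y v
      simp [negAdPow_succ_apply]
    rw [this]
    exact B.br.contDiff.neg.clm_comp ih

theorem negAdPow_mem (k j : ℕ) (y : L) {v : L} (hv : v ∈ B.filt j) :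
    B.negAdPow k y v ∈ B.filt (j + k) := by
  induction k with
  | zero => simpa using hv
  | succ k ih =>
    rw [negAdPow_succ_apply]
    have := B.br_mem (B.mem_filt_zero y) ih
    have h2 : j + (k + 1) = 0 + (j + k) + 1 := by ring
    rw [h2]
    exact neg_mem this

theorem fderiv_negAdPow_zero (y u v : L) :
    fderiv 𝕜 (fun z => B.negAdPow 0 z v) y u = 0 := by
  simp

theorem fderiv_negAdPow_succ (k : ℕ) (y u v : L) :
    fderiv 𝕜 (fun z => B.negAdPow (k + 1) z v) y u =
      -B.br u (B.negAdPow k y v) - B.br y (fderiv 𝕜 (fun z => B.negAdPow k z v) y u) := by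
  have hd : DifferentiableAt 𝕜 (fun z => B.negAdPow k z v) y :=
    (((B.contDiff_negAdPow k (n := 1)).clm_apply contDiff_const).differentiable one_ne_zero) y
  simp only [negAdPow_succ_apply]
  rw [fderiv_fun_neg]
  rw [neg_apply, B.fderiv_br (f := fun z => z) differentiableAt_id hd]
  simp [sub_eq_add_neg, add_comm]

/-- This is the Maurer–Cartan equation degree by degree. Since ad y is a derivation, each induction
step raises the power on one of the two factors, and Pascal's rule collects the coefficients. -/
theorem fderiv_negAdPow_succ_sub (n : ℕ) (y u v : L) :
    fderiv 𝕜 (fun z => B.negAdPow (n + 1) z v) y u -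
      fderiv 𝕜 (fun z => B.negAdPow (n + 1) z u) y v =
    -∑ p ∈ Finset.HasAntidiagonal.antidiagonal n, ((n + 2).choose (p.1 + 1) : 𝕜) •
      B.br (B.negAdPow p.1 y u) (B.negAdPow p.2 y v) := by
  induction n with
  | zero =>
    rw [fderiv_negAdPow_succ, fderiv_negAdPow_succ, fderiv_negAdPow_zero, fderiv_negAdPow_zero]
    simp only [negAdPow_zero_apply]
    rw [B.skew v u]
    simp [two_smul]
    abel
  | succ n ih =>
    rw [fderiv_negAdPow_succ B (n + 1) y u v, fderiv_negAdPow_succ B (n + 1) y v u]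
    have h1 : -B.br u (B.negAdPow (n + 1) y v) -
        B.br y (fderiv 𝕜 (fun z => B.negAdPow (n + 1) z v) y u) -
        (-B.br v (B.negAdPow (n + 1) y u) -
          B.br y (fderiv 𝕜 (fun z => B.negAdPow (n + 1) z u) y v)) =
        -B.br u (B.negAdPow (n + 1) y v) - B.br (B.negAdPow (n + 1) y u) v
        - B.br y (fderiv 𝕜 (fun z => B.negAdPow (n + 1) z v) y u -
          fderiv 𝕜 (fun z => B.negAdPow (n + 1) z u) y v) := by
      rw [map_sub, B.skew v]
      abel
    rw [h1, ih, map_neg, map_sum]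
    have h2 : ∀ p : ℕ × ℕ, B.br y (((n + 2).choose (p.1 + 1) : 𝕜) •
        B.br (B.negAdPow p.1 y u) (B.negAdPow p.2 y v)) =
        -(((n + 2).choose (p.1 + 1) : 𝕜) • B.br (B.negAdPow (p.1 + 1) y u) (B.negAdPow p.2 y v) +
          ((n + 2).choose (p.1 + 1) : 𝕜) •
            B.br (B.negAdPow p.1 y u) (B.negAdPow (p.2 + 1) y v)) := by
      intro p
      rw [map_smul, B.leibniz, negAdPow_succ_apply, negAdPow_succ_apply, map_neg, map_neg]
      simp only [smul_add, smul_neg, neg_apply]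
      abel
    rw [Finset.sum_congr rfl fun p _ => h2 p, Finset.sum_neg_distrib, Finset.sum_add_distrib]
    have h3 : ∀ p : ℕ × ℕ, ((n + 1 + 2).choose (p.1 + 1) : 𝕜) •
        B.br (B.negAdPow p.1 y u) (B.negAdPow p.2 y v) =
        ((n + 2).choose p.1 : 𝕜) • B.br (B.negAdPow p.1 y u) (B.negAdPow p.2 y v) +
        ((n + 2).choose (p.1 + 1) : 𝕜) • B.br (B.negAdPow p.1 y u) (B.negAdPow p.2 y v) := by
      intro p
      rw [← add_smul, show n + 1 + 2 = (n + 2) + 1 by ring, Nat.choose_succ_succ]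
      push_cast
      rfl
    rw [Finset.sum_congr rfl fun p _ => h3 p, Finset.sum_add_distrib]
    -- The two end terms have binomial coefficient 1; they are the brackets with a bare u or a bare
    -- v produced by differentiating the outermost factor.
    rw [Finset.Nat.sum_antidiagonal_succ (f := fun p : ℕ × ℕ => ((n + 2).choose p.1 : 𝕜) •
      B.br (B.negAdPow p.1 y u) (B.negAdPow p.2 y v)),
      Finset.Nat.sum_antidiagonal_succ' (f := fun p : ℕ × ℕ => ((n + 2).choose (p.1 + 1) : 𝕜) •
      B.br (B.negAdPow p.1 y u) (B.negAdPow p.2 y v))]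
    simp
    abel

/-- The left-trivialized derivative of the exponential map in exponential coordinates. -/
def mcForm (y : L) : L →L[𝕜] L :=
  ∑ k ∈ Finset.range (N + 1), (((k + 1).factorial : 𝕜)⁻¹) • B.negAdPow k y

theorem mcForm_apply (y v : L) :
    B.mcForm y v = ∑ k ∈ Finset.range (N + 1), (((k + 1).factorial : 𝕜)⁻¹) • B.negAdPow k y v := by
  simp [mcForm]

theorem contDiff_mcForm {n : WithTop ℕ∞} : ContDiff 𝕜 n B.mcForm := by
  unfold mcForm
  exact ContDiff.sum fun k _ => (B.contDiff_negAdPow k).const_smul _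

/-- The k = 0 term of the series is the identity and every other term contains ad y, which raises
the filtration. Thus `mcForm` is unipotent, and a finite Neumann series inverts it. -/
theorem mcForm_sub_mem (y : L) {j : ℕ} {v : L} (hv : v ∈ B.filt j) :
    v - B.mcForm y v ∈ B.filt (j + 1) := by
  rw [mcForm_apply, Finset.sum_range_succ']
  simp only [zero_add, Nat.factorial_one, Nat.cast_one, inv_one, negAdPow_zero_apply, one_smul]
  rw [sub_add_eq_sub_sub_swap, sub_self, zero_sub]
  refine neg_mem (Submodule.sum_mem _ fun k _ => Submodule.smul_mem _ _ ?_)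
  exact B.filt_anti (by omega) (B.negAdPow_mem (k + 1) j y hv)

/-- The Maurer-Cartan equation. -/
theorem maurerCartan (y u v : L) :
    fderiv 𝕜 B.mcForm y u v - fderiv 𝕜 B.mcForm y v u = -B.br (B.mcForm y u) (B.mcForm y v) := by
  have hd : ∀ (k : ℕ) (v : L), DifferentiableAt 𝕜 (fun z => B.negAdPow k z v) y := fun k v =>
    (((B.contDiff_negAdPow k (n := 1)).clm_apply contDiff_const).differentiable one_ne_zero) y
  have h1 : ∀ u v, fderiv 𝕜 B.mcForm y u v = ∑ k ∈ Finset.range (N + 1),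
      (((k + 1).factorial : 𝕜)⁻¹) • fderiv 𝕜 (fun z => B.negAdPow k z v) y u := by
    intro u v
    have h2 : fderiv 𝕜 B.mcForm y u v = fderiv 𝕜 (fun z => B.mcForm z v) y u := by
      have := ((B.contDiff_mcForm (n := 1)).differentiable one_ne_zero y).hasFDerivAt.clm_apply
        (hasFDerivAt_const v y)
      rw [this.fderiv]
      simp
    rw [h2]
    simp only [mcForm_apply]
    rw [fderiv_fun_sum fun k _ => (hd k v).fun_const_smul _]
    simp only [sum_apply]
    refine Finset.sum_congr rfl fun k _ => ?_
    rw [fderiv_fun_const_smul (hd k v)]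
    rfl
  rw [h1, h1, ← Finset.sum_sub_distrib]
  simp only [← smul_sub]
  rw [Finset.sum_range_succ', fderiv_negAdPow_zero, fderiv_negAdPow_zero, sub_zero, smul_zero,
    add_zero]
  have h3 : ∀ n, ((n + 1 + 1).factorial : 𝕜)⁻¹ •
      (fderiv 𝕜 (fun z => B.negAdPow (n + 1) z v) y u -
        fderiv 𝕜 (fun z => B.negAdPow (n + 1) z u) y v) =
      -∑ p ∈ Finset.HasAntidiagonal.antidiagonal n, (((p.1 + 1).factorial : 𝕜)⁻¹ *
        ((p.2 + 1).factorial : 𝕜)⁻¹) • B.br (B.negAdPow p.1 y u) (B.negAdPow p.2 y v) := by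
    intro n
    rw [fderiv_negAdPow_succ_sub, smul_neg, Finset.smul_sum]
    congr 1
    refine Finset.sum_congr rfl fun p hp => ?_
    rw [smul_smul]
    congr 1
    rw [Finset.HasAntidiagonal.mem_antidiagonal] at hp
    have h4 : n + 2 = (p.2 + 1) + (p.1 + 1) := by omega
    have h5 := Nat.add_choose_mul_factorial_mul_factorial (p.2 + 1) (p.1 + 1)
    rw [← h4] at h5
    have h6 : ((n + 2).choose (p.1 + 1) : 𝕜) * (p.1 + 1).factorial * (p.2 + 1).factorial =
        (n + 1 + 1).factorial := by
      rw [mul_right_comm]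
      exact_mod_cast h5
    have a1 : ((p.1 + 1).factorial : 𝕜) ≠ 0 := by exact_mod_cast (Nat.factorial_ne_zero _)
    have a2 : ((p.2 + 1).factorial : 𝕜) ≠ 0 := by exact_mod_cast (Nat.factorial_ne_zero _)
    have a3 : ((n + 1 + 1).factorial : 𝕜) ≠ 0 := by exact_mod_cast (Nat.factorial_ne_zero _)
    field_simp
    rw [← h6]
  rw [Finset.sum_congr rfl fun n _ => h3 n, Finset.sum_neg_distrib]
  congr 1
  -- One side sums over the triangle i + j < N, the other over the square i, j ≤ N; nilpotency kills
  -- the terms that are not shared.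
  have h7 : ∀ i j, N ≤ i + j + 1 → B.br (B.negAdPow i y u) (B.negAdPow j y v) = 0 := by
    intro i j hij
    refine B.eq_zero_of_mem_filt hij ?_
    have := B.br_mem (B.negAdPow_mem i 0 y (B.mem_filt_zero u))
      (B.negAdPow_mem j 0 y (B.mem_filt_zero v))
    simpa using this
  simp only [mcForm_apply, map_sum, sum_apply, map_smul, smul_apply, Finset.smul_sum, smul_smul]
  rw [Finset.sum_sigma', ← Finset.sum_product']
  symm
  refine Finset.sum_bij_ne_zero (fun p _ _ => ⟨p.2 + p.1, (p.2, p.1)⟩) ?_ ?_ ?_ ?_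
  · intro p hp h0
    simp only [Finset.mem_sigma, Finset.mem_range, Finset.HasAntidiagonal.mem_antidiagonal, and_true]
    by_contra hlt
    exact h0 (by rw [h7 _ _ (by omega), smul_zero])
  · rintro ⟨a, b⟩ - - ⟨c, d⟩ - - h
    simp only [Sigma.mk.injEq] at h
    have := eq_of_heq h.2
    simp only [Prod.mk.injEq] at this
    ext
    · exact this.2
    · exact this.1
  · rintro ⟨n, i, j⟩ hb h0
    simp only [Finset.mem_sigma, Finset.mem_range, Finset.HasAntidiagonal.mem_antidiagonal] at hb
    refine ⟨(j, i), ?_, ?_, ?_⟩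
    · simp; omega
    · rw [mul_comm]
      exact h0
    · obtain ⟨_, rfl⟩ := hb
      rfl
  · intro p hp h0
    rw [mul_comm]

end

end NilpotentBracket

/-! ### Left-invariant fields and the jet of the identity map. -/

namespace NilpotentBracket

noncomputable section

variable {𝕜 L : Type*} [RCLike 𝕜] [NormedAddCommGroup L] [NormedSpace 𝕜 L] {N : ℕ}
  (B : NilpotentBracket 𝕜 L N)

/-- The left-invariant vector fields in exponential coordinates; the inverse of `mcForm`. -/
def frame (y : L) : L →L[𝕜] L := ∑ i ∈ Finset.range N, (1 - B.mcForm y) ^ i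

theorem one_sub_mcForm_pow_mem (y : L) (i j : ℕ) {v : L} (hv : v ∈ B.filt j) :
    ((1 - B.mcForm y) ^ i) v ∈ B.filt (j + i) := by
  induction i with
  | zero => simpa using hv
  | succ i ih =>
    rw [pow_succ', mul_apply_eq_comp]
    exact B.mcForm_sub_mem y ih

theorem one_sub_mcForm_pow (y : L) : (1 - B.mcForm y) ^ N = 0 := by
  ext v
  exact B.eq_zero_of_mem_filt (by omega) (B.one_sub_mcForm_pow_mem y N 0 (B.mem_filt_zero v))

theorem mcForm_mul_frame (y : L) : B.mcForm y * B.frame y = 1 := by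
  have := mul_neg_geom_sum (1 - B.mcForm y) N
  rwa [one_sub_mcForm_pow, sub_zero, sub_sub_cancel] at this

theorem frame_mul_mcForm (y : L) : B.frame y * B.mcForm y = 1 := by
  have := geom_sum_mul_neg (1 - B.mcForm y) N
  rwa [one_sub_mcForm_pow, sub_zero, sub_sub_cancel] at this

theorem mcForm_frame (y v : L) : B.mcForm y (B.frame y v) = v :=
  congrArg (fun T : L →L[𝕜] L => T v) (B.mcForm_mul_frame y)

theorem frame_mcForm (y v : L) : B.frame y (B.mcForm y v) = v :=
  congrArg (fun T : L →L[𝕜] L => T v) (B.frame_mul_mcForm y)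

theorem contDiff_frame {n : WithTop ℕ∞} : ContDiff 𝕜 n B.frame := by
  unfold frame
  exact ContDiff.sum fun k _ => (contDiff_const.sub B.contDiff_mcForm).pow k

theorem contDiff_frame_apply {n : WithTop ℕ∞} (a : L) : ContDiff 𝕜 n (fun y => B.frame y a) :=
  B.contDiff_frame.clm_apply contDiff_const

/-- Since [z,z] = 0, the field X_z is constant along the line 𝕜z: one-parameter subgroups are
straight lines. -/
theorem frame_self_smul (c : 𝕜) (z : L) : B.frame (c • z) z = z := by
  have hself : B.br z z = 0 := by
    have := B.skew z z
    rwa [eq_neg_iff_add_eq_zero, ← two_smul 𝕜, smul_eq_zero, or_iff_right two_ne_zero] at this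
  have h : B.mcForm (c • z) z = z := by
    rw [mcForm_apply, Finset.sum_range_succ', Finset.sum_eq_zero]
    · simp
    · intro k _
      have : B.negAdPow (k + 1) (c • z) z = 0 := by
        rw [negAdPow, pow_succ, mul_apply_eq_comp]
        have h0 : (-B.br (c • z)) z = 0 := by simp [hself]
        exact (congrArg _ h0).trans (map_zero ((-B.br (c • z)) ^ k))
      rw [this, smul_zero]
  exact (congrArg _ h.symm).trans (B.frame_mcForm (c • z) z)

/-- Differentiating `mcForm` y (X_a y) = a turns the Maurer–Cartan equation for the form into the
bracket relation for the dual frame. -/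
theorem lieBracket_frame (y a b : L) :
    fderiv 𝕜 (fun z => B.frame z b) y (B.frame y a) -
      fderiv 𝕜 (fun z => B.frame z a) y (B.frame y b) = B.frame y (B.br a b) := by
  have key : ∀ u a, fderiv 𝕜 B.mcForm y u (B.frame y a) +
      B.mcForm y (fderiv 𝕜 (fun z => B.frame z a) y u) = 0 := by
    intro u a
    have h1 := ((B.contDiff_mcForm (n := 1)).differentiable one_ne_zero y).hasFDerivAt.clm_apply
      ((B.contDiff_frame_apply (n := 1) a).differentiable one_ne_zero y).hasFDerivAt
    simp only [mcForm_frame] at h1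
    have h2 := h1.unique (hasFDerivAt_const a y)
    have h3 := congrArg (fun T : L →L[𝕜] L => T u) h2
    simpa [add_comm] using h3
  have h := B.maurerCartan y (B.frame y a) (B.frame y b)
  rw [eq_neg_of_add_eq_zero_left (key _ b), eq_neg_of_add_eq_zero_left (key _ a), mcForm_frame,
    mcForm_frame, neg_sub_neg, ← map_sub, eq_neg_iff_add_eq_zero] at h
  rw [← B.frame_mcForm y (_ - _)]
  congr 1
  rw [← neg_sub, map_neg]
  rwa [neg_eq_iff_add_eq_zero]

/-- Maps built from constants, the identity and the bracket; the index counts the constants,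
weighted by their position in the filtration. -/
inductive IsLiePoly : ℕ → (L → L) → Prop
  | id : IsLiePoly 0 (fun y => y)
  | const {j : ℕ} {x : L} (hx : x ∈ B.filt j) : IsLiePoly (j + 1) (fun _ => x)
  | br {i j : ℕ} {f g : L → L} (hf : IsLiePoly i f) (hg : IsLiePoly j g) :
      IsLiePoly (i + j) (fun y => B.br (f y) (g y))
  | add {j : ℕ} {f g : L → L} (hf : IsLiePoly j f) (hg : IsLiePoly j g) :
      IsLiePoly j (fun y => f y + g y)
  | smul {j : ℕ} (c : 𝕜) {f : L → L} (hf : IsLiePoly j f) : IsLiePoly j (fun y => c • f y)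

namespace IsLiePoly

variable {B}

theorem contDiff {j : ℕ} {f : L → L} (hf : B.IsLiePoly j f) {n : WithTop ℕ∞} :
    ContDiff 𝕜 n f := by
  induction hf with
  | id => exact contDiff_id
  | const => exact contDiff_const
  | br _ _ hf hg => exact B.contDiff_br hf hg
  | add _ _ hf hg => exact hf.add hg
  | smul c _ hf => exact hf.const_smul c

/-- At the origin every occurrence of the identity vanishes, so only brackets of constants survive.
A constant in step j weighs j + 1, which absorbs the +1 in `br_mem`. In index 0 the truncated j - 1
says nothing, hence the second clause. -/
theorem zero_mem {j : ℕ} {f : L → L} (hf : B.IsLiePoly j f) :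
    f 0 ∈ B.filt (j - 1) ∧ (j = 0 → f 0 = 0) := by
  induction hf with
  | id => simp
  | const hx => simpa using hx
  | @br i j f g _ _ hf hg =>
    rcases Nat.eq_zero_or_pos i with rfl | hi
    · simp [hf.2 rfl]
    rcases Nat.eq_zero_or_pos j with rfl | hj
    · simp [hg.2 rfl]
    refine ⟨?_, by omega⟩
    have := B.br_mem hf.1 hg.1
    have e : i - 1 + (j - 1) + 1 = i + j - 1 := by omega
    rwa [e] at this
  | add _ _ hf hg =>
    exact ⟨add_mem hf.1 hg.1, fun h => by simp [hf.2 h, hg.2 h]⟩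
  | smul c _ hf => exact ⟨Submodule.smul_mem _ c hf.1, fun h => by simp [hf.2 h]⟩

theorem zero (j : ℕ) : B.IsLiePoly j (fun _ => (0 : L)) := by
  rcases j with _ | j
  · simpa using (IsLiePoly.id (B := B)).smul 0
  · exact const (Submodule.zero_mem _)

theorem sum {ι : Type*} (s : Finset ι) {j : ℕ} {f : ι → L → L}
    (hf : ∀ i ∈ s, B.IsLiePoly j (f i)) : B.IsLiePoly j (fun y => ∑ i ∈ s, f i y) := by
  classical
  induction s using Finset.induction_on with
  | empty => simpa using zero j
  | insert a s ha ih =>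
    simp only [Finset.sum_insert ha]
    exact (hf a (by simp)).add (ih fun i hi => hf i (by simp [hi]))

theorem negAdPow {j : ℕ} {f : L → L} (hf : B.IsLiePoly j f) (k : ℕ) :
    B.IsLiePoly j (fun y => B.negAdPow k y (f y)) := by
  induction k with
  | zero => simpa using hf
  | succ k ih =>
    simp only [negAdPow_succ_apply]
    simpa using (IsLiePoly.id.br ih).smul (-1)

theorem mcForm {j : ℕ} {f : L → L} (hf : B.IsLiePoly j f) :
    B.IsLiePoly j (fun y => B.mcForm y (f y)) := by
  simp only [mcForm_apply]
  exact sum _ fun k _ => (hf.negAdPow k).smul _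

theorem frame {j : ℕ} {f : L → L} (hf : B.IsLiePoly j f) :
    B.IsLiePoly j (fun y => B.frame y (f y)) := by
  simp only [NilpotentBracket.frame, sum_apply]
  refine sum _ fun k hk => ?_
  clear hk
  induction k with
  | zero => simpa using hf
  | succ k ih =>
    simp only [pow_succ', mul_apply_eq_comp, sub_apply,
      one_apply_eq_self]
    simpa [sub_eq_add_neg] using ih.add (ih.mcForm.smul (-1))

/-- By the product rule, one occurrence of the identity at a time is replaced by X_x, itself a Lie
polynomial with a single constant x. -/
theorem fderiv_frame {i j : ℕ} {f : L → L} (hf : B.IsLiePoly i f) {x : L} (hx : x ∈ B.filt j) :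
    B.IsLiePoly (i + (j + 1)) (fun y => fderiv 𝕜 f y (B.frame y x)) := by
  induction hf with
  | id => simpa using (const hx).frame
  | const => simpa using zero _
  | @br i₁ i₂ f g hf hg ihf ihg =>
    have : (fun y => fderiv 𝕜 (fun y => B.br (f y) (g y)) y (B.frame y x)) = fun y =>
        B.br (fderiv 𝕜 f y (B.frame y x)) (g y) + B.br (f y) (fderiv 𝕜 g y (B.frame y x)) := by
      ext y
      exact B.fderiv_br (hf.contDiff (n := 1).differentiable one_ne_zero y)
        (hg.contDiff (n := 1).differentiable one_ne_zero y) _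
    rw [this]
    refine add ?_ ?_
    · have := ihf.br hg
      rwa [show i₁ + (j + 1) + i₂ = i₁ + i₂ + (j + 1) by ring] at this
    · have := hf.br ihg
      rwa [← add_assoc] at this
  | @add i f g hf hg ihf ihg =>
    have : (fun y => fderiv 𝕜 (fun y => f y + g y) y (B.frame y x)) = fun y =>
        fderiv 𝕜 f y (B.frame y x) + fderiv 𝕜 g y (B.frame y x) := by
      ext y
      rw [fderiv_fun_add (hf.contDiff (n := 1).differentiable one_ne_zero y)
        (hg.contDiff (n := 1).differentiable one_ne_zero y)]
      rfl
    rw [this]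
    exact ihf.add ihg
  | @smul i c f hf ih =>
    have : (fun y => fderiv 𝕜 (fun y => c • f y) y (B.frame y x)) = fun y =>
        c • fderiv 𝕜 f y (B.frame y x) := by
      ext y
      rw [fderiv_fun_const_smul (hf.contDiff (n := 1).differentiable one_ne_zero y)]
      rfl
    rw [this]
    exact ih.smul c

end IsLiePoly

/-- Iterated derivatives of the identity along left-invariant vector fields. -/
def iterDeriv : List L → L → L
  | [] => fun y => y
  | x :: l => fun y => fderiv 𝕜 (iterDeriv l) y (B.frame y x)

theorem iterDeriv_cons (x : L) (l : List L) (y : L) :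
    B.iterDeriv (x :: l) y = fderiv 𝕜 (B.iterDeriv l) y (B.frame y x) := rfl

theorem isLiePoly_iterDeriv (l : List L) : B.IsLiePoly l.length (B.iterDeriv l) := by
  induction l with
  | nil => exact .id
  | cons x l ih => exact ih.fderiv_frame (B.mem_filt_zero x)

theorem contDiff_iterDeriv (l : List L) {n : WithTop ℕ∞} : ContDiff 𝕜 n (B.iterDeriv l) :=
  (B.isLiePoly_iterDeriv l).contDiff

theorem iterDeriv_zero_of_length_gt {l : List L} (hl : N < l.length) : B.iterDeriv l 0 = 0 :=
  B.eq_zero_of_mem_filt (by omega) (B.isLiePoly_iterDeriv l).zero_mem.1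

theorem iterDeriv_cons_zero_mem {j : ℕ} {x : L} (hx : x ∈ B.filt j) (l : List L) :
    B.iterDeriv (x :: l) 0 ∈ B.filt (j + l.length) := by
  have := ((B.isLiePoly_iterDeriv l).fderiv_frame hx).zero_mem.1
  rwa [← add_assoc, Nat.add_sub_cancel, add_comm] at this

theorem iterDeriv_singleton_zero (x : L) : B.iterDeriv [x] 0 = x := by
  have := B.frame_self_smul 0 x
  rw [zero_smul] at this
  simpa [iterDeriv] using this

/-- In X_a X_b f - X_b X_a f the second derivatives of f cancel by symmetry and what remains is
X_[a,b] f. Therefore the jet of the identity factors through the enveloping algebra. -/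
theorem iterDeriv_swap (l₁ l₂ : List L) (a b : L) (y : L) :
    B.iterDeriv (l₁ ++ a :: b :: l₂) y - B.iterDeriv (l₁ ++ b :: a :: l₂) y =
      B.iterDeriv (l₁ ++ B.br a b :: l₂) y := by
  induction l₁ generalizing y with
  | nil =>
    set f := B.iterDeriv l₂ with hf
    have hd : HasFDerivAt (fderiv 𝕜 f) (fderiv 𝕜 (fderiv 𝕜 f) y) y :=
      ((((B.contDiff_iterDeriv l₂ (n := 2)).fderiv_right (m := 1) (by norm_num)).differentiable
        one_ne_zero) y).hasFDerivAt
    have h : ∀ a b, B.iterDeriv (a :: b :: l₂) y =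
        fderiv 𝕜 (fderiv 𝕜 f) y (B.frame y a) (B.frame y b) +
          fderiv 𝕜 f y (fderiv 𝕜 (fun z => B.frame z b) y (B.frame y a)) := by
      intro a b
      rw [iterDeriv_cons]
      have := hd.clm_apply
        ((B.contDiff_frame_apply (n := 1) b).differentiable one_ne_zero y).hasFDerivAt
      have h2 : B.iterDeriv (b :: l₂) = fun z => fderiv 𝕜 f z (B.frame z b) := rfl
      rw [h2, this.fderiv]
      simp [add_comm]
    have hs : IsSymmSndFDerivAt 𝕜 f y :=
      ((B.contDiff_iterDeriv l₂ (n := 2)).contDiffAt).isSymmSndFDerivAt (by simp)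
    rw [List.nil_append, List.nil_append, List.nil_append, h, h, hs.eq (B.frame y a),
      add_sub_add_left_eq_sub, ← map_sub, lieBracket_frame]
    rfl
  | cons x l ih =>
    have hd := fun l => (B.contDiff_iterDeriv l (n := 1)).differentiable one_ne_zero y
    simp only [List.cons_append, iterDeriv_cons]
    rw [← sub_apply, ← fderiv_sub (hd _) (hd _)]
    congr 2
    ext z
    exact ih z

/-- Along the line 𝕜z, an integral curve of X_z, the identity has constant derivative z, so all
further derivatives vanish. This is what makes the logarithm linear on exponentials. -/
theorem iterDeriv_replicate (z : L) (k : ℕ) (c : 𝕜) :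
    B.iterDeriv (List.replicate (k + 2) z) (c • z) = 0 := by
  have h1 : ∀ c : 𝕜, B.iterDeriv (List.replicate 1 z) (c • z) = z := by
    intro c
    simpa [iterDeriv] using B.frame_self_smul c z
  have key : ∀ (k : ℕ) (a : L), (∀ c : 𝕜, B.iterDeriv (List.replicate k z) (c • z) = a) →
      ∀ c : 𝕜, B.iterDeriv (List.replicate (k + 1) z) (c • z) = 0 := by
    intro k a h c
    rw [List.replicate_succ, iterDeriv_cons, frame_self_smul]
    have hd := ((B.contDiff_iterDeriv (List.replicate k z) (n := 1)).differentiable one_ne_zero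
      (c • z)).hasFDerivAt
    have h2 : HasDerivAt (fun t : 𝕜 => t • z) z c := by
      simpa using (hasDerivAt_id c).smul_const z
    have h3 := hd.comp_hasDerivAt c h2
    have h4 : (B.iterDeriv (List.replicate k z) ∘ fun t : 𝕜 => t • z) = fun _ => a := by
      ext t
      exact h t
    rw [h4] at h3
    exact h3.unique (hasDerivAt_const c a)
  induction k generalizing c with
  | zero => exact key 1 z h1 c
  | succ k ih => exact key (k + 2) 0 ih c

/-- `iterDeriv` as a multilinear map. -/
def iterDerivMultilinear : (k : ℕ) → L → (L [×k]→L[𝕜] L)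
  | 0 => fun y => ContinuousMultilinearMap.uncurry0 𝕜 L y
  | k + 1 => fun y =>
    ContinuousLinearMap.uncurryLeft ((fderiv 𝕜 (iterDerivMultilinear k) y).comp (B.frame y))

theorem contDiff_iterDerivMultilinear (k : ℕ) :
    ContDiff 𝕜 ∞ (B.iterDerivMultilinear k) := by
  induction k with
  | zero => exact (continuousMultilinearCurryFin0 𝕜 L L).symm.toContinuousLinearEquiv.contDiff
  | succ k ih =>
    have h1 : ContDiff 𝕜 ∞ fun y => (fderiv 𝕜 (B.iterDerivMultilinear k) y).comp (B.frame y) :=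
      (ih.fderiv_right (m := ∞) (by simp)).clm_comp B.contDiff_frame
    exact (continuousMultilinearCurryLeftEquiv 𝕜 (fun _ : Fin (k + 1) => L)
      L).symm.toContinuousLinearEquiv.contDiff.comp h1

/-- The iterated derivatives thus come from bounded multilinear maps, so that they define an element
of the Banach space of jets. -/
theorem iterDerivMultilinear_apply (l : List L) (y : L) :
    B.iterDerivMultilinear l.length y l.get = B.iterDeriv l y := by
  induction l generalizing y with
  | nil => rfl
  | cons x l ih =>
    have hd : DifferentiableAt 𝕜 (B.iterDerivMultilinear l.length) y :=
      ((B.contDiff_iterDerivMultilinear _).differentiable (by simp)) y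
    have h1 : B.iterDerivMultilinear (x :: l).length y (x :: l).get =
        fderiv 𝕜 (B.iterDerivMultilinear l.length) y (B.frame y x) l.get := rfl
    rw [h1, iterDeriv_cons]
    have h2 : B.iterDeriv l = fun z =>
        ContinuousMultilinearMap.apply 𝕜 (fun _ : Fin l.length => L) L l.get
          (B.iterDerivMultilinear l.length z) := by
      ext z
      exact (ih z).symm
    have h3 := (ContinuousMultilinearMap.apply 𝕜 (fun _ : Fin l.length => L) L
      l.get).hasFDerivAt.comp y hd.hasFDerivAt
    rw [h2]
    exact (congrArg (fun T : L →L[𝕜] L => T (B.frame y x)) h3.fderiv).symm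

end

end NilpotentBracket

/-! ### Truncated sequences of multilinear maps. -/

noncomputable section

/-- Restriction of a family of operators to maps between two subspaces. -/
def ContinuousLinearMap.restrictFamily {𝕜 L M : Type*} [RCLike 𝕜] [NormedAddCommGroup L]
    [NormedSpace 𝕜 L] [NormedAddCommGroup M] [NormedSpace 𝕜 M] (T : L →L[𝕜] M →L[𝕜] M)
    (p q : Submodule 𝕜 M) (h : ∀ x, ∀ m ∈ p, T x m ∈ q) : L →L[𝕜] p →L[𝕜] q :=
  LinearMap.mkContinuous₂ (LinearMap.mk₂ 𝕜 (fun x (m : p) => (⟨T x m, h x m m.2⟩ : q))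
    (by intros; ext; simp) (by intros; ext; simp) (by intros; ext; simp) (by intros; ext; simp))
    ‖T‖ (fun x m => T.le_opNorm₂ x m)

@[simp] theorem ContinuousLinearMap.coe_restrictFamily_apply {𝕜 L M : Type*} [RCLike 𝕜]
    [NormedAddCommGroup L] [NormedSpace 𝕜 L] [NormedAddCommGroup M] [NormedSpace 𝕜 M]
    (T : L →L[𝕜] M →L[𝕜] M) (p q : Submodule 𝕜 M) (h : ∀ x, ∀ m ∈ p, T x m ∈ q) (x : L) (m : p) :
    (T.restrictFamily p q h x m : M) = T x m := rfl

section Jets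

variable (𝕜 L V : Type*) [RCLike 𝕜] [NormedAddCommGroup L] [NormedSpace 𝕜 L]
  [NormedAddCommGroup V] [NormedSpace 𝕜 V] (N : ℕ)

/-- Sequences of multilinear maps of degree at most `N`. -/
abbrev MultilinearSeq := (k : Fin (N + 1)) → (L [×(k : ℕ)]→L[𝕜] V)

variable {𝕜 L V N}

/-- Evaluation of a sequence of multilinear maps at a word. -/
def MultilinearSeq.ev (l : List L) : MultilinearSeq 𝕜 L V N →L[𝕜] V :=
  if h : l.length < N + 1 then
    (ContinuousMultilinearMap.apply 𝕜 (fun _ : Fin l.length => L) V l.get).comp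
      (ContinuousLinearMap.proj (R := 𝕜)
        (φ := fun k : Fin (N + 1) => (L [×(k : ℕ)]→L[𝕜] V)) ⟨l.length, h⟩)
  else 0

namespace MultilinearSeq

theorem ev_of_lt {l : List L} (h : l.length < N + 1) (m : MultilinearSeq 𝕜 L V N) :
    ev l m = m ⟨l.length, h⟩ l.get := by
  simp [ev, h]

theorem ev_of_not_lt {l : List L} (h : ¬ l.length < N + 1) (m : MultilinearSeq 𝕜 L V N) :
    ev l m = 0 := by
  simp [ev, h]

theorem ext_ev {m m' : MultilinearSeq 𝕜 L V N} (h : ∀ l, ev l m = ev l m') : m = m' := by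
  ext ⟨k, hk⟩ v
  obtain ⟨l, rfl, hl⟩ : ∃ (l : List L) (hl : l.length = k), v = l.get ∘ Fin.cast hl.symm :=
    ⟨List.ofFn v, by simp, by ext i; simp⟩
  have hl' : v = l.get := hl
  rw [hl', ← ev_of_lt, ← ev_of_lt, h]

variable (𝕜 L V N) in
/-- Insertion of a vector in the first slot, up to sign. -/
def shift : L →L[𝕜] MultilinearSeq 𝕜 L V N →L[𝕜] MultilinearSeq 𝕜 L V N :=
  LinearMap.mkContinuous₂ (LinearMap.mk₂ 𝕜
    (fun (x : L) (m : MultilinearSeq 𝕜 L V N) (k : Fin (N + 1)) =>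
      if h : (k : ℕ) + 1 < N + 1 then -(m ⟨k + 1, h⟩).curryLeft x else 0)
    (by intro x y m; ext k : 1; by_cases h : (k : ℕ) + 1 < N + 1 <;>
        simp only [h, dite_true, dite_false, map_add, neg_add, Pi.add_apply, add_zero])
    (by intro c x m; ext k : 1; by_cases h : (k : ℕ) + 1 < N + 1 <;>
        simp only [h, dite_true, dite_false, map_smul, smul_neg, Pi.smul_apply, smul_zero])
    (by
      intro x m m'; ext k : 1
      by_cases h : (k : ℕ) + 1 < N + 1
      · simp only [h, dite_true, Pi.add_apply]
        rw [← neg_add]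
        rfl
      · simp only [h, dite_false, Pi.add_apply, add_zero])
    (by
      intro c x m; ext k : 1
      by_cases h : (k : ℕ) + 1 < N + 1
      · simp only [h, dite_true, Pi.smul_apply]
        rw [smul_neg]
        rfl
      · simp only [h, dite_false, Pi.smul_apply, smul_zero]))
    1 (by
      intro x m
      rw [one_mul, pi_norm_le_iff_of_nonneg (by positivity)]
      intro k
      by_cases h : (k : ℕ) + 1 < N + 1
      · simp only [LinearMap.mk₂_apply, h, dite_true, norm_neg]
        refine (ContinuousLinearMap.le_opNorm _ _).trans ?_
        rw [ContinuousMultilinearMap.curryLeft_norm, mul_comm]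
        exact mul_le_mul_of_nonneg_left (norm_le_pi_norm m _) (norm_nonneg _)
      · simp only [LinearMap.mk₂_apply, h, dite_false, norm_zero]
        positivity)

/-- In top degree both sides are 0, by the convention for words longer than N. Insertion reverses
the order of products; the sign makes it a representation rather than an anti-representation. -/
theorem ev_shift (l : List L) (x : L) (m : MultilinearSeq 𝕜 L V N) :
    ev l (shift 𝕜 L V N x m) = -ev (x :: l) m := by
  by_cases h : l.length + 1 < N + 1
  · rw [ev_of_lt (by omega), ev_of_lt (by simpa using h)]
    have : shift 𝕜 L V N x m ⟨l.length, by omega⟩ = -(m ⟨l.length + 1, h⟩).curryLeft x :=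
      dif_pos h
    rw [this, neg_apply, ContinuousMultilinearMap.curryLeft_apply]
    congr 2
    ext i
    refine Fin.cases ?_ (fun j => ?_) i <;> rfl
  · rw [ev_of_not_lt (l := x :: l) (by simpa using h), neg_zero]
    by_cases h' : l.length < N + 1
    · rw [ev_of_lt h']
      have : shift 𝕜 L V N x m ⟨l.length, h'⟩ = 0 := dif_neg h
      rw [this]
      rfl
    · rw [ev_of_not_lt h']

end MultilinearSeq

end Jets

end

/-! ### The nilpotent representation and its logarithm. -/

noncomputable section

/-- A representation of a nilpotent bracket by nilpotent operators which preserves a finite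
filtration, together with a linear map which inverts the exponential. -/
structure NilpotentRep {𝕜 L : Type*} [RCLike 𝕜] [NormedAddCommGroup L] [NormedSpace 𝕜 L] {N : ℕ}
    (B : NilpotentBracket 𝕜 L N) (F : Type*) [NormedAddCommGroup F] [NormedSpace 𝕜 F] where
  /-- the representation -/
  rep : L →L[𝕜] F →L[𝕜] F
  rep_br : ∀ x y, rep (B.br x y) = rep x * rep y - rep y * rep x
  rep_pow : ∀ x, rep x ^ (N + 1) = 0
  /-- the filtration -/
  filt : ℕ → Submodule 𝕜 F
  filt_zero : filt 0 = ⊥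
  filt_last : filt (N + 1) = ⊤
  filt_mono : Monotone filt
  rep_mem : ∀ (j : ℕ) (x : L), ∀ m ∈ filt (j + 1), rep x m ∈ filt j
  /-- a logarithm -/
  log : (F →L[𝕜] F) →L[𝕜] L
  log_exp : ∀ x, log (NormedSpace.exp (rep x)) = x
  log_exp_mul : ∀ x, ∃ e : L ≃L[𝕜] L, ∀ y, e y = log (NormedSpace.exp (rep x) * rep y)

theorem NormedSpace.exp_eq_sum_of_pow_eq_zero (𝕜 : Type*) {A : Type*} [RCLike 𝕜] [NormedRing A]
    [NormedAlgebra 𝕜 A] [CompleteSpace A] {a : A} {n : ℕ} (ha : a ^ n = 0) :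
    NormedSpace.exp a = ∑ k ∈ Finset.range n, ((k.factorial : 𝕜)⁻¹) • a ^ k := by
  rw [NormedSpace.exp_eq_tsum 𝕜]
  refine tsum_eq_sum fun k hk => ?_
  rw [Finset.mem_range, not_lt] at hk
  rw [pow_eq_zero_of_le hk ha, smul_zero]

namespace NilpotentBracket

open MultilinearSeq

variable {𝕜 L : Type*} [RCLike 𝕜] [NormedAddCommGroup L] [NormedSpace 𝕜 L] {N : ℕ}
  (B : NilpotentBracket 𝕜 L N)

/-- The sequences which factor through the enveloping algebra. -/
def repSpace : Submodule 𝕜 (MultilinearSeq 𝕜 L (L × 𝕜) N) where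
  carrier := {m | ∀ l₁ l₂ a b, ev (l₁ ++ a :: b :: l₂) m - ev (l₁ ++ b :: a :: l₂) m =
    ev (l₁ ++ B.br a b :: l₂) m}
  add_mem' := by
    intro m m' h h' l₁ l₂ a b
    rw [map_add, map_add, map_add, ← h, ← h']
    abel
  zero_mem' := by intro l₁ l₂ a b; simp
  smul_mem' := by
    intro c m h l₁ l₂ a b
    rw [map_smul, map_smul, map_smul, ← h, smul_sub]

theorem isClosed_repSpace : IsClosed (B.repSpace : Set (MultilinearSeq 𝕜 L (L × 𝕜) N)) := by
  have : (B.repSpace : Set (MultilinearSeq 𝕜 L (L × 𝕜) N)) =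
      ⋂ (l₁ : List L) (l₂ : List L) (a : L) (b : L), {m | ev (l₁ ++ a :: b :: l₂) m -
        ev (l₁ ++ b :: a :: l₂) m = ev (l₁ ++ B.br a b :: l₂) m} := by
    ext m
    simp only [Set.mem_iInter]
    rfl
  rw [this]
  refine isClosed_iInter fun l₁ => isClosed_iInter fun l₂ => isClosed_iInter fun a =>
    isClosed_iInter fun b => isClosed_eq ?_ ?_
  · exact (ContinuousLinearMap.continuous _).sub (ContinuousLinearMap.continuous _)
  · exact ContinuousLinearMap.continuous _

theorem shift_mem_repSpace (x : L) (m : MultilinearSeq 𝕜 L (L × 𝕜) N) (hm : m ∈ B.repSpace) :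
    shift 𝕜 L (L × 𝕜) N x m ∈ B.repSpace := by
  intro l₁ l₂ a b
  simp only [ev_shift]
  rw [neg_sub_neg, ← neg_sub]
  exact congrArg _ (hm (x :: l₁) l₂ a b)

/-- The normed space of sequences which factor through the enveloping algebra. -/
def RepSpace : Type _ := B.repSpace

instance : NormedAddCommGroup B.RepSpace := inferInstanceAs (NormedAddCommGroup B.repSpace)

instance : NormedSpace 𝕜 B.RepSpace := inferInstanceAs (NormedSpace 𝕜 B.repSpace)

instance [CompleteSpace L] : CompleteSpace B.RepSpace :=
  B.isClosed_repSpace.completeSpace_coe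

/-- The representation by insertion of vectors. -/
def rep : L →L[𝕜] B.RepSpace →L[𝕜] B.RepSpace :=
  (shift 𝕜 L (L × 𝕜) N).restrictFamily B.repSpace B.repSpace B.shift_mem_repSpace

/-- Evaluation at a word on the representation space. -/
def evRep (l : List L) : B.RepSpace →L[𝕜] L × 𝕜 :=
  ((ev l).comp B.repSpace.subtypeL : B.repSpace →L[𝕜] L × 𝕜)

/-- The underlying sequence. -/
def RepSpace.val (m : B.RepSpace) : MultilinearSeq 𝕜 L (L × 𝕜) N := Subtype.val (m : B.repSpace)

theorem evRep_apply (l : List L) (m : B.RepSpace) : B.evRep l m = ev l (RepSpace.val B m) := rfl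

theorem val_rep (x : L) (m : B.RepSpace) :
    RepSpace.val B (B.rep x m) = shift 𝕜 L (L × 𝕜) N x (RepSpace.val B m) := rfl

theorem evRep_ext {m m' : B.RepSpace} (h : ∀ l, B.evRep l m = B.evRep l m') : m = m' :=
  Subtype.ext (ext_ev h)

theorem evRep_rep (l : List L) (x : L) (m : B.RepSpace) :
    B.evRep l (B.rep x m) = -B.evRep (x :: l) m := by
  rw [evRep_apply, evRep_apply, val_rep, ev_shift]

theorem evRep_of_length_gt {l : List L} (h : N < l.length) (m : B.RepSpace) : B.evRep l m = 0 :=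
  ev_of_not_lt (by omega) _

theorem evRep_rep_pow (l : List L) (x : L) (k : ℕ) (m : B.RepSpace) :
    B.evRep l ((B.rep x ^ k) m) = (-1 : 𝕜) ^ k • B.evRep (List.replicate k x ++ l) m := by
  induction k generalizing l with
  | zero => simp
  | succ k ih =>
    rw [pow_succ', mul_apply_eq_comp, evRep_rep, ih, pow_succ,
      List.replicate_succ']
    simp

theorem rep_br (x y : L) : B.rep (B.br x y) = B.rep x * B.rep y - B.rep y * B.rep x := by
  ext1 m
  refine B.evRep_ext fun l => ?_
  rw [sub_apply, map_sub, mul_apply_eq_comp, mul_apply_eq_comp]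
  simp only [evRep_rep, neg_neg]
  rw [← neg_sub]
  exact congrArg _ (m.2 [] l x y).symm

/-- The filtration by degree. -/
def repFilt (j : ℕ) : Submodule 𝕜 B.RepSpace where
  carrier := {m | ∀ l : List L, j ≤ l.length → B.evRep l m = 0}
  add_mem' := by
    intro m m' h h' l hl
    rw [map_add, h l hl, h' l hl, add_zero]
  zero_mem' := by intro l hl; simp
  smul_mem' := by
    intro c m h l hl
    rw [map_smul, h l hl, smul_zero]

/-- The sequence of iterated derivatives at the origin. -/
def canonicalSeq : B.RepSpace :=
  ⟨fun k => (ContinuousLinearMap.inl 𝕜 L 𝕜).compContinuousMultilinearMap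
    (B.iterDerivMultilinear k 0), by
    have h : ∀ l : List L, ev l (fun k : Fin (N + 1) =>
        (ContinuousLinearMap.inl 𝕜 L 𝕜).compContinuousMultilinearMap
          (B.iterDerivMultilinear k 0)) = (B.iterDeriv l 0, (0 : 𝕜)) := by
      intro l
      by_cases hl : l.length < N + 1
      · rw [ev_of_lt hl, ← B.iterDerivMultilinear_apply]
        rfl
      · rw [ev_of_not_lt hl, B.iterDeriv_zero_of_length_gt (by omega)]
        rfl
    intro l₁ l₂ a b
    rw [h, h, h, ← B.iterDeriv_swap]
    simp⟩

theorem evRep_canonicalSeq (l : List L) :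
    B.evRep l B.canonicalSeq = (B.iterDeriv l 0, (0 : 𝕜)) := by
  by_cases hl : l.length < N + 1
  · rw [← B.iterDerivMultilinear_apply]
    exact ev_of_lt hl _
  · rw [B.iterDeriv_zero_of_length_gt (by omega)]
    exact ev_of_not_lt hl _

/-- The coordinate map on operators: the derivative of the identity. -/
def repLog : (B.RepSpace →L[𝕜] B.RepSpace) →L[𝕜] L :=
  -((ContinuousLinearMap.fst 𝕜 L 𝕜).comp ((B.evRep []).comp
    (ContinuousLinearMap.apply 𝕜 B.RepSpace B.canonicalSeq)))

theorem repLog_apply (T : B.RepSpace →L[𝕜] B.RepSpace) :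
    B.repLog T = -(B.evRep [] (T B.canonicalSeq)).1 := rfl

theorem repLog_rep_pow (x : L) (k : ℕ) :
    B.repLog (B.rep x ^ k) = -((-1 : 𝕜) ^ k • B.iterDeriv (List.replicate k x) 0) := by
  rw [repLog_apply, evRep_rep_pow, List.append_nil, evRep_canonicalSeq]
  rfl

theorem repLog_rep_pow_mul (x y : L) (k : ℕ) :
    B.repLog (B.rep x ^ k * B.rep y) =
      (-1 : 𝕜) ^ k • B.iterDeriv (y :: List.replicate k x) 0 := by
  rw [repLog_apply, mul_apply_eq_comp, evRep_rep_pow, List.append_nil,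
    evRep_rep, evRep_canonicalSeq]
  simp

theorem rep_pow (x : L) : B.rep x ^ (N + 1) = 0 := by
  ext1 m
  refine B.evRep_ext fun l => ?_
  rw [evRep_rep_pow, evRep_of_length_gt _ (by simp; omega)]
  simp

variable [CompleteSpace L]

/-- Of the exponential series applied to the jet of the identity only the linear term survives: the
constant term is the identity evaluated at 0, and the higher ones vanish by `iterDeriv_replicate`.
-/
theorem repLog_exp (x : L) : B.repLog (NormedSpace.exp (B.rep x)) = x := by
  -- Exponent N + 2 rather than N + 1, so that the terms of degree 0 and 1 can be split off even
  -- when N = 0.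
  rw [NormedSpace.exp_eq_sum_of_pow_eq_zero 𝕜 (pow_eq_zero_of_le (Nat.le_succ _) (B.rep_pow x)),
    map_sum]
  simp only [map_smul, repLog_rep_pow]
  rw [Finset.sum_range_succ', Finset.sum_range_succ', Finset.sum_eq_zero]
  · simp [iterDeriv_singleton_zero]
    rfl
  · intro k _
    have := B.iterDeriv_replicate x k 0
    rw [zero_smul] at this
    rw [add_assoc, this]
    simp

/-- The term k = 0 of the series gives back y, and the terms with k > 0 lie deeper in the filtration
than y. The map is therefore unipotent. -/
theorem repLog_exp_mul (x : L) :
    ∃ e : L ≃L[𝕜] L, ∀ y, e y = B.repLog (NormedSpace.exp (B.rep x) * B.rep y) := by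
  let T : L →L[𝕜] L := B.repLog.comp
    ((ContinuousLinearMap.mul 𝕜 (B.RepSpace →L[𝕜] B.RepSpace) (NormedSpace.exp (B.rep x))).comp
      B.rep)
  have hT : ∀ y, T y = B.repLog (NormedSpace.exp (B.rep x) * B.rep y) := fun y => rfl
  have hmem : ∀ (j : ℕ) (y : L), y ∈ B.filt j → (1 - T) y ∈ B.filt (j + 1) := by
    intro j y hy
    rw [sub_apply, hT, NormedSpace.exp_eq_sum_of_pow_eq_zero 𝕜 (B.rep_pow x), Finset.sum_mul,
      map_sum, Finset.sum_range_succ']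
    simp only [smul_mul_assoc, map_smul, repLog_rep_pow_mul]
    simp only [List.replicate_zero, iterDeriv_singleton_zero, Nat.factorial_zero, Nat.cast_one,
      inv_one, pow_zero, one_smul, one_apply_eq_self]
    rw [sub_add_eq_sub_sub_swap, sub_self, zero_sub]
    refine neg_mem (Submodule.sum_mem _ fun k _ => Submodule.smul_mem _ _
      (Submodule.smul_mem _ _ ?_))
    have := B.iterDeriv_cons_zero_mem hy (List.replicate (k + 1) x)
    exact B.filt_anti (by simp) this
  have hpow : ∀ (i : ℕ) (y : L), ((1 - T) ^ i) y ∈ B.filt i := by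
    intro i y
    induction i with
    | zero => exact B.mem_filt_zero _
    | succ i ih =>
      rw [pow_succ']
      exact hmem i _ ih
  have hnil : IsNilpotent (1 - T) := ⟨N, by
    ext y
    exact B.eq_zero_of_mem_filt le_rfl (hpow N y)⟩
  have hu : IsUnit T := by
    have := hnil.isUnit_one_sub
    rwa [sub_sub_cancel] at this
  obtain ⟨U, hU⟩ := hu
  exact ⟨ContinuousLinearEquiv.unitsEquiv 𝕜 L U, fun y => by rw [← hT, ← hU]; rfl⟩

/-- The representation on sequences of multilinear maps. -/
def nilpotentRep : NilpotentRep B B.RepSpace where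
  rep := B.rep
  rep_br := B.rep_br
  rep_pow := B.rep_pow
  filt := B.repFilt
  filt_zero := by
    rw [eq_bot_iff]
    intro m hm
    rw [Submodule.mem_bot]
    exact B.evRep_ext fun l => by rw [hm l (Nat.zero_le _), map_zero]
  filt_last := by
    rw [eq_top_iff]
    intro m _ l hl
    exact B.evRep_of_length_gt hl m
  filt_mono := fun i j hij m hm l hl => hm l (hij.trans hl)
  rep_mem := by
    intro j x m hm l hl
    rw [evRep_rep, hm (x :: l) (by simpa using hl), neg_zero]
  log := B.repLog
  log_exp := B.repLog_exp
  log_exp_mul := B.repLog_exp_mul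

end NilpotentBracket

end

/-! ### The theorem for Banach–Lie algebras. -/

noncomputable section

/-- The bracket of a nilpotent Lie algebra, transported to a normed space where it is
continuous. -/
def NilpotentBracket.ofLieAlgebra {𝕜 L : Type*} [RCLike 𝕜] [NormedAddCommGroup L]
    [NormedSpace 𝕜 L] {𝔤 : Type*} [LieRing 𝔤] [LieAlgebra 𝕜 𝔤] (φ : L ≃ₗ[𝕜] 𝔤)
    (br : L →L[𝕜] L →L[𝕜] L) (hbr : ∀ x y, φ (br x y) = ⁅φ x, φ y⁆) {N : ℕ}
    (hN : LieModule.lowerCentralSeries 𝕜 𝔤 𝔤 N = ⊥) : NilpotentBracket 𝕜 L N where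
  br := br
  skew x y := by
    apply φ.injective
    rw [map_neg, hbr, hbr, lie_skew]
  leibniz x y z := by
    apply φ.injective
    rw [map_add, hbr, hbr, hbr, hbr, hbr, hbr, leibniz_lie]
  filt i := (LieModule.lowerCentralSeries 𝕜 𝔤 𝔤 i).toSubmodule.comap φ.toLinearMap
  filt_zero := by simp
  filt_last := by rw [hN]; ext x; simp
  br_mem := by
    intro i j x y hx hy
    simp only [Submodule.mem_comap, LinearEquiv.coe_coe, LieSubmodule.mem_toSubmodule] at hx hy ⊢
    rw [hbr]
    exact lie_mem_lowerCentralSeries_add hx hy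
  filt_anti := fun i j hij x hx => LieModule.antitone_lowerCentralSeries 𝕜 𝔤 𝔤 hij hx

theorem add_one_le_two_pow_mul_add_one (N : ℕ) : N + 1 ≤ 2 ^ (N - 1) * N + 1 := by
  have : 1 * N ≤ 2 ^ (N - 1) * N := Nat.mul_le_mul_right N Nat.one_le_two_pow
  omega

theorem NilpotentRep.rep_injective {𝕜 L : Type*} [RCLike 𝕜] [NormedAddCommGroup L]
    [NormedSpace 𝕜 L] {N : ℕ} {B : NilpotentBracket 𝕜 L N} {F : Type*} [NormedAddCommGroup F]
    [NormedSpace 𝕜 F] (R : NilpotentRep B F) : Function.Injective R.rep := fun x y h => by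
  rw [← R.log_exp x, h, R.log_exp]

/-- Nilpotent Banach-Lie algebras have faithful representations by nilpotent operators. -/
theorem exists_faithful_rep_of_lowerCentralSeries_eq_bot {𝕜 : Type u} [RCLike 𝕜] (N : ℕ)
    (L : Type v) [NormedLieRing L] [NormedLieAlgebra 𝕜 L] [CompleteSpace L]
    (hN : LieModule.lowerCentralSeries 𝕜 L L N = ⊥) :
    ∃ (F : Type (max u v)) (_ : NormedAddCommGroup F) (_ : NormedSpace 𝕜 F)
      (_ : CompleteSpace F) (ρ : L →L[𝕜] (F →L[𝕜] F)),
      (∀ x y : L, ρ ⁅x, y⁆ = ρ x * ρ y - ρ y * ρ x) ∧ Function.Injective ρ ∧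
      ∀ x : L, (ρ x) ^ (2 ^ (N - 1) * N + 1) = 0 := by
  obtain ⟨C, hC⟩ := NormedLieRing.exists_norm_lie_le (L := L)
  let br : L →L[𝕜] L →L[𝕜] L :=
    LinearMap.mkContinuous₂ (LieModule.toEnd 𝕜 L L : L →ₗ[𝕜] L →ₗ[𝕜] L) C hC
  let B : NilpotentBracket 𝕜 L N :=
    NilpotentBracket.ofLieAlgebra (𝔤 := L) (LinearEquiv.refl 𝕜 L) br (fun _ _ => rfl) hN
  exact ⟨B.RepSpace, inferInstance, inferInstance, inferInstance, B.rep, B.rep_br,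
    B.nilpotentRep.rep_injective,
    fun x => pow_eq_zero_of_le (add_one_le_two_pow_mul_add_one N) (B.rep_pow x)⟩

end

/-! ### Extension of local homomorphisms. -/

section LocalHom

open Topology Filter Bundle

variable {G H : Type*} [TopologicalSpace G] [Group G] [IsTopologicalGroup G] [Group H]

theorem tendsto_inv_mul_nhds_one (x : G) : Tendsto (fun y => x⁻¹ * y) (𝓝 x) (𝓝 1) := by
  have : Tendsto (fun y => x⁻¹ * y) (𝓝 x) (𝓝 (x⁻¹ * x)) := (continuous_const_mul x⁻¹).tendsto x
  rwa [inv_mul_cancel] at this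

/-- The flat bundle of extensions of a local homomorphism. -/
@[reducible]
def localHomBundleCore [TopologicalSpace H] [DiscreteTopology H] (U : Set G) (hU : IsOpen U)
    (h1 : (1 : G) ∈ U) (f : G → H)
    (hf : ∀ a ∈ U, ∀ᶠ u in 𝓝 (1 : G), f (a * u) = f a * f u) : FiberBundleCore G G H where
  baseSet i := {x | i⁻¹ * x ∈ U}
  isOpen_baseSet i := hU.preimage (continuous_const_mul i⁻¹)
  indexAt x := x
  mem_baseSet_at x := by simpa using h1
  coordChange i j x v := v * f (i⁻¹ * x) * (f (j⁻¹ * x))⁻¹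
  coordChange_self i x _ v := by simp
  coordChange_comp i j k x _ v := by simp [mul_assoc]
  continuousOn_coordChange i j := by
    rintro ⟨x, v⟩ ⟨⟨hi, hj⟩, -⟩
    refine ContinuousAt.continuousWithinAt ?_
    -- With p.1 = x u for u near 1, both values of f acquire the same right factor f(u), which
    -- cancels: the transition functions are locally constant.
    have e : (fun p : G × H => p.2 * f (i⁻¹ * p.1) * (f (j⁻¹ * p.1))⁻¹) =ᶠ[𝓝 (x, v)]
        fun p => p.2 * f (i⁻¹ * x) * (f (j⁻¹ * x))⁻¹ := by
      have h2 : Tendsto (fun p : G × H => x⁻¹ * p.1) (𝓝 (x, v)) (𝓝 1) :=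
        (tendsto_inv_mul_nhds_one x).comp continuous_fst.continuousAt
      filter_upwards [h2.eventually (hf _ hi), h2.eventually (hf _ hj)] with p hp hq
      rw [mul_assoc, mul_inv_cancel_left] at hp hq
      rw [hp, hq]
      group
    refine ContinuousAt.congr ?_ e.symm
    exact (continuous_of_discreteTopology (f := fun v : H => v * f (i⁻¹ * x) *
      (f (j⁻¹ * x))⁻¹)).continuousAt.comp continuous_snd.continuousAt

/-- On a simply connected group a local homomorphism extends to a homomorphism. -/
theorem exists_monoidHom_of_local [SimplyConnectedSpace G] [LocallyPathConnectedSpace G]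
    (U : Set G) (hU : IsOpen U) (h1 : (1 : G) ∈ U) (f : G → H)
    (hf : ∀ a ∈ U, ∀ᶠ u in 𝓝 (1 : G), f (a * u) = f a * f u) :
    ∃ φ : G →* H, ∀ᶠ u in 𝓝 (1 : G), φ u = f u := by
  -- A discrete fibre turns the flat bundle into a covering of G, and lifting the identity of G
  -- gives a global section.
  let : TopologicalSpace H := ⊥
  have : DiscreteTopology H := ⟨rfl⟩
  have f1 : f 1 = 1 := by
    have := (hf 1 h1).self_of_nhds
    simpa using this
  let Z := localHomBundleCore U hU h1 f hf
  have cov : IsCoveringMap (π H Z.Fiber) := FiberBundle.isCoveringMap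
  obtain ⟨s, ⟨hs1, hs⟩, -⟩ := cov.existsUnique_continuousMap_lifts (ContinuousMap.id G) (1 : G)
    (⟨1, (1 : H)⟩ : TotalSpace H Z.Fiber) rfl
  have hproj : ∀ x, (s x).proj = x := fun x => congrFun hs x
  let p : G → H := fun x => (s x).snd
  have p1 : p 1 = 1 := by
    change (s 1).snd = (1 : H)
    rw [hs1]
  have hloc : ∀ x, ∀ᶠ u in 𝓝 (1 : G), p (x * u) = p x * f u := by
    intro x
    -- In the trivialization indexed by x the section is y ↦ p(y) f(x⁻¹y)⁻¹, which is locally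
    -- constant because the fibre is discrete.
    have hc : ContinuousAt (fun y => ((Z.localTriv x) (s y)).2) x := by
      have hmem : s x ∈ (Z.localTriv x).source := by
        rw [Z.mem_localTriv_source, hproj]
        exact Z.mem_baseSet_at x
      exact (((Z.localTriv x).continuousOn.continuousAt
        ((Z.localTriv x).open_source.mem_nhds hmem)).comp s.continuous.continuousAt).snd
    have hval : ∀ y, ((Z.localTriv x) (s y)).2 = p y * (f (x⁻¹ * y))⁻¹ := by
      intro y
      rw [Z.localTriv_apply]
      change p y * f ((s y).proj⁻¹ * (s y).proj) * (f (x⁻¹ * (s y).proj))⁻¹ = _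
      rw [inv_mul_cancel, f1, mul_one, hproj]
    simp only [hval] at hc
    have hc2 : Tendsto (fun u => x * u) (𝓝 1) (𝓝 x) := by
      have := (continuous_const_mul x).tendsto (1 : G)
      rwa [mul_one] at this
    have := (hc.tendsto.comp hc2).eventually (isOpen_discrete {p x * (f (x⁻¹ * x))⁻¹}
      |>.mem_nhds rfl)
    filter_upwards [this] with u hu
    simp only [Function.comp_apply, inv_mul_cancel_left, inv_mul_cancel, f1, inv_one, mul_one] at hu
    rw [← hu]
    group
  have hmul : ∀ g h, p (g * h) = p g * p h := by
    intro g
    -- Moving h by a small u multiplies both sides by f(u), so whether the identity holds is a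
    -- locally constant property of h.
    have hclopen : IsClopen {h | p (g * h) = p g * p h} := by
      have key : ∀ h, ∀ᶠ y in 𝓝 h, (p (g * y) = p g * p y ↔ p (g * h) = p g * p h) := by
        intro h
        filter_upwards [(tendsto_inv_mul_nhds_one h).eventually (hloc (g * h)),
          (tendsto_inv_mul_nhds_one h).eventually (hloc h)] with y hy1 hy2
        rw [mul_assoc, mul_inv_cancel_left] at hy1
        rw [mul_inv_cancel_left] at hy2
        rw [hy1, hy2, ← mul_assoc, mul_left_inj]
      constructor
      · rw [← isOpen_compl_iff, isOpen_iff_mem_nhds]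
        intro h hh
        filter_upwards [key h] with y hy using fun h2 => hh (hy.1 h2)
      · rw [isOpen_iff_mem_nhds]
        intro h hh
        filter_upwards [key h] with y hy using hy.2 hh
    have := hclopen.eq_univ ⟨1, by simp [p1]⟩
    intro h
    exact (this ▸ Set.mem_univ h : h ∈ {h | p (g * h) = p g * p h})
  refine ⟨⟨⟨p, p1⟩, hmul⟩, ?_⟩
  filter_upwards [hloc 1] with u hu
  simpa [p1] using hu

end LocalHom

/-! ### The flat equation dP = P ρ(θ). -/

section Flat

open Metric

/-- Poincaré lemma on a ball. -/
theorem exists_primitive_ball {𝕜 E F : Type*} [RCLike 𝕜] [NormedAddCommGroup E] [NormedSpace 𝕜 E]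
    [NormedAddCommGroup F] [NormedSpace 𝕜 F] [CompleteSpace F] (e : E) (r : ℝ) (c : F)
    (α : E → E →L[𝕜] F) (α' : E → E →L[𝕜] E →L[𝕜] F)
    (hα : ∀ z ∈ ball e r, HasFDerivAt α (α' z) z)
    (hsymm : ∀ z ∈ ball e r, ∀ u v, α' z u v = α' z v u) :
    ∃ f : E → F, f e = c ∧ ∀ z ∈ ball e r, HasFDerivAt f (α z) z := by
  let : NormedSpace ℝ E := .restrictScalars ℝ 𝕜 E
  let : NormedSpace ℝ F := .restrictScalars ℝ 𝕜 F
  obtain ⟨f, hf⟩ := (convex_ball e r).exists_forall_hasFDerivWithinAt_of_hasFDerivWithinAt_symmetric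
    (fun z hz => ((hα z hz).restrictScalars ℝ).hasFDerivWithinAt)
    (fun z hz u _ v _ => hsymm z hz u v)
  refine ⟨fun z => f z + (c - f e), by simp, fun z hz => ?_⟩
  exact ((hf z hz).hasFDerivAt (isOpen_ball.mem_nhds hz)).add_const _

variable {𝕜 E L F : Type*} [RCLike 𝕜] [NormedAddCommGroup E] [NormedSpace 𝕜 E]
  [NormedAddCommGroup L] [NormedSpace 𝕜 L] [NormedAddCommGroup F] [NormedSpace 𝕜 F]

theorem eqOn_ball_of_hasFDerivAt {e : E} {r : ℝ} {f g : E → F} {f' : E → E →L[𝕜] F}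
    (hf : ∀ z ∈ ball e r, HasFDerivAt f (f' z) z) (hg : ∀ z ∈ ball e r, HasFDerivAt g (f' z) z)
    (h : f e = g e) : Set.EqOn f g (ball e r) := by
  let : NormedSpace ℝ E := .restrictScalars ℝ 𝕜 E
  rcases le_or_gt r 0 with hr | hr
  · rw [ball_eq_empty.2 hr]
    exact Set.eqOn_empty _ _
  refine isOpen_ball.eqOn_of_fderiv_eq (𝕜 := 𝕜) (convex_ball e r).isPreconnected
    (fun z hz => (hf z hz).differentiableAt.differentiableWithinAt)
    (fun z hz => (hg z hz).differentiableAt.differentiableWithinAt)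
    (fun z hz => by rw [(hf z hz).fderiv, (hg z hz).fderiv]) (mem_ball_self hr) h

variable {N : ℕ} {B : NilpotentBracket 𝕜 L N}

theorem NilpotentRep.rep_mem_self (R : NilpotentRep B F) (j : ℕ) (x : L) (m : F)
    (hm : m ∈ R.filt j) : R.rep x m ∈ R.filt j :=
  R.rep_mem j x m (R.filt_mono (Nat.le_succ j) hm)

/-- Since ρ(θ) maps step j + 1 into step j, the right-hand side on step j + 1 involves only the
solution already found on step j. Each step is thus a primitive of a known 1-form. -/
theorem NilpotentRep.exists_flat_filt [CompleteSpace F] (R : NilpotentRep B F) (e : E) (r : ℝ)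
    (θ : E → E →L[𝕜] L) (θ' : E → E →L[𝕜] E →L[𝕜] L)
    (hθ : ∀ z ∈ ball e r, HasFDerivAt θ (θ' z) z)
    (hmc : ∀ z ∈ ball e r, ∀ u v, θ' z u v - θ' z v u = -B.br (θ z u) (θ z v)) (j : ℕ) :
    ∃ P : E → (R.filt j →L[𝕜] F), P e = (R.filt j).subtypeL ∧
      ∀ z ∈ ball e r, HasFDerivAt P ((ContinuousLinearMap.compL 𝕜 (R.filt j) (R.filt j) F (P z)) ∘L
        (R.rep.restrictFamily _ _ (R.rep_mem_self j)) ∘L θ z) z := by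
  induction j with
  | zero =>
    refine ⟨fun _ => (R.filt 0).subtypeL, rfl, fun z _ => ?_⟩
    convert hasFDerivAt_const _ _
    ext u ⟨m, hm⟩
    rw [R.filt_zero, Submodule.mem_bot] at hm
    simp [hm]
  | succ j ih =>
    obtain ⟨P, hP0, hP⟩ := ih
    let ρ := R.rep.restrictFamily _ _ (R.rep_mem j)
    let C := ContinuousLinearMap.compL 𝕜 (R.filt (j + 1)) (R.filt j) F
    let α : E → E →L[𝕜] (R.filt (j + 1) →L[𝕜] F) := fun z => (C (P z)) ∘L (ρ ∘L θ z)
    have hα : ∀ z ∈ ball e r, HasFDerivAt α _ z := fun z hz =>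
      (C.hasFDerivAt.comp z (hP z hz)).clm_comp
        ((hasFDerivAt_const ρ z).clm_comp (hθ z hz))
    -- The form is closed: the equation for P contributes the commutator of ρ(θ u) and ρ(θ v), which
    -- the Maurer–Cartan equation for θ cancels.
    obtain ⟨Q, hQ0, hQ⟩ := exists_primitive_ball e r ((R.filt (j + 1)).subtypeL) α _ hα (by
      intro z hz u v
      ext m
      have h1 : θ' z u v = θ' z v u - B.br (θ z u) (θ z v) := by
        rw [sub_eq_add_neg, ← hmc z hz u v]
        abel
      have h2 := congrArg (fun T : F →L[𝕜] F => T m) (R.rep_br (θ z u) (θ z v))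
      simp only [sub_apply, mul_apply_eq_comp] at h2
      simp only [ContinuousLinearMap.comp_zero, add_zero, add_apply,
        ContinuousLinearMap.coe_comp, Function.comp_apply, ContinuousLinearMap.compL_apply,
        ContinuousLinearMap.flip_apply, C, ρ]
      rw [← map_add, ← map_add]
      congr 1
      ext
      simp only [Submodule.coe_add, ContinuousLinearMap.coe_restrictFamily_apply]
      rw [h1, map_sub, sub_apply, h2]
      abel)
    let ι : R.filt j →L[𝕜] R.filt (j + 1) :=
      (R.filt j).subtypeL.codRestrict (R.filt (j + 1)) fun m => R.filt_mono (Nat.le_succ j) m.2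
    -- Uniqueness of primitives shows that Q extends P, so P may be replaced by Q on the right-hand
    -- side.
    have hQP : ∀ z ∈ ball e r, (Q z) ∘L ι = P z := by
      have h1 : ∀ z ∈ ball e r, HasFDerivAt (fun z => (Q z) ∘L ι)
          ((ContinuousLinearMap.compL 𝕜 (R.filt j) (R.filt j) F (P z)) ∘L
        (R.rep.restrictFamily _ _ (R.rep_mem_self j)) ∘L θ z) z := by
        intro z hz
        exact (((ContinuousLinearMap.compL 𝕜 (R.filt j) (R.filt (j + 1)) F).flip
          ι).hasFDerivAt.comp z (hQ z hz))
      refine eqOn_ball_of_hasFDerivAt h1 hP ?_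
      rw [hQ0, hP0]
      rfl
    refine ⟨Q, hQ0, fun z hz => ?_⟩
    have h3 : α z = (ContinuousLinearMap.compL 𝕜 (R.filt (j + 1)) (R.filt (j + 1)) F (Q z)) ∘L
        (R.rep.restrictFamily _ _ (R.rep_mem_self (j + 1))) ∘L θ z := by
      ext u m
      change P z (ρ (θ z u) m) = _
      rw [← hQP z hz]
      rfl
    rw [← h3]
    exact hQ z hz

/-- The flat equation `dP = P ⬝ ρ(θ)` has a solution on a ball. -/
theorem NilpotentRep.exists_flat [CompleteSpace F] (R : NilpotentRep B F) (e : E) (r : ℝ)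
    (θ : E → E →L[𝕜] L) (θ' : E → E →L[𝕜] E →L[𝕜] L)
    (hθ : ∀ z ∈ ball e r, HasFDerivAt θ (θ' z) z)
    (hmc : ∀ z ∈ ball e r, ∀ u v, θ' z u v - θ' z v u = -B.br (θ z u) (θ z v)) :
    ∃ P : E → (F →L[𝕜] F), P e = 1 ∧
      ∀ z ∈ ball e r, HasFDerivAt P ((ContinuousLinearMap.mul 𝕜 (F →L[𝕜] F) (P z)) ∘L
        R.rep ∘L θ z) z := by
  obtain ⟨P, hP0, hP⟩ := R.exists_flat_filt e r θ θ' hθ hmc (N + 1)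
  let ι : F →L[𝕜] R.filt (N + 1) :=
    (ContinuousLinearMap.id 𝕜 F).codRestrict (R.filt (N + 1)) fun m => by simp [R.filt_last]
  refine ⟨fun z => (P z) ∘L ι, by
    change (P e) ∘L ι = 1
    rw [hP0]
    rfl, fun z hz => ?_⟩
  exact ((ContinuousLinearMap.compL 𝕜 F (R.filt (N + 1)) F).flip ι).hasFDerivAt.comp z (hP z hz)

end Flat

/-! ### The Maurer–Cartan form of the group in a chart. -/

noncomputable section LieGroupChart

open Topology Filter VectorField

variable (𝕜 E G : Type*) [RCLike 𝕜] [NormedAddCommGroup E] [NormedSpace 𝕜 E]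
  [TopologicalSpace G] [ChartedSpace E G] [Group G]

/-- The preferred chart at the identity. -/
abbrev oneChart : PartialEquiv G E := extChartAt 𝓘(𝕜, E) (1 : G)

variable {E} in
/-- The multiplication in the chart at the identity. -/
def chartMul (z w : E) : E := oneChart 𝕜 E G ((oneChart 𝕜 E G).symm z * (oneChart 𝕜 E G).symm w)

variable {E} in
/-- The left-invariant vector fields in the chart at the identity. -/
def chartFrame (z : E) : E →L[𝕜] E := fderiv 𝕜 (chartMul 𝕜 G z) (oneChart 𝕜 E G 1)

theorem oneChart_target_mem_nhds {z : E} (hz : z ∈ (oneChart 𝕜 E G).target) :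
    (oneChart 𝕜 E G).target ∈ 𝓝 z :=
  (isOpen_extChartAt_target (I := 𝓘(𝕜, E)) (1 : G)).mem_nhds hz

theorem oneChart_symm_apply_one : (oneChart 𝕜 E G).symm (oneChart 𝕜 E G 1) = 1 :=
  extChartAt_to_inv (I := 𝓘(𝕜, E)) (1 : G)

theorem chartMul_apply_one {z : E} (hz : z ∈ (oneChart 𝕜 E G).target) :
    chartMul 𝕜 G z (oneChart 𝕜 E G 1) = z := by
  rw [chartMul, oneChart_symm_apply_one, mul_one]
  exact (oneChart 𝕜 E G).right_inv hz

theorem chartFrame_one : chartFrame 𝕜 G (oneChart 𝕜 E G 1) = 1 := by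
  have : chartMul 𝕜 G (oneChart 𝕜 E G 1) =ᶠ[𝓝 (oneChart 𝕜 E G 1)] id := by
    filter_upwards [oneChart_target_mem_nhds 𝕜 E G (mem_extChartAt_target (I := 𝓘(𝕜, E)) (1 : G))]
      with w hw
    rw [chartMul, oneChart_symm_apply_one, one_mul]
    exact (oneChart 𝕜 E G).right_inv hw
  rw [chartFrame, this.fderiv_eq, fderiv_id]
  rfl

theorem eventually_chartMul_mem_source [IsTopologicalGroup G] {z : E}
    (hz : z ∈ (oneChart 𝕜 E G).target) :
    ∀ᶠ w in 𝓝 (oneChart 𝕜 E G 1),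
      (oneChart 𝕜 E G).symm z * (oneChart 𝕜 E G).symm w ∈ (oneChart 𝕜 E G).source := by
  have hc : ContinuousAt (fun w => (oneChart 𝕜 E G).symm z * (oneChart 𝕜 E G).symm w)
      (oneChart 𝕜 E G 1) :=
    continuousAt_const.mul (continuousAt_extChartAt_symm (I := 𝓘(𝕜, E)) (1 : G))
  have hm : (oneChart 𝕜 E G).source ∈
      𝓝 ((oneChart 𝕜 E G).symm z * (oneChart 𝕜 E G).symm (oneChart 𝕜 E G 1)) := by
    rw [oneChart_symm_apply_one, mul_one]
    exact (isOpen_extChartAt_source (I := 𝓘(𝕜, E)) (1 : G)).mem_nhds ((oneChart 𝕜 E G).map_target hz)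
  exact hc hm

theorem oneChart_symm_chartMul [IsTopologicalGroup G] {z : E} (hz : z ∈ (oneChart 𝕜 E G).target) :
    ∀ᶠ w in 𝓝 (oneChart 𝕜 E G 1), (oneChart 𝕜 E G).symm (chartMul 𝕜 G z w) =
      (oneChart 𝕜 E G).symm z * (oneChart 𝕜 E G).symm w :=
  (eventually_chartMul_mem_source 𝕜 E G hz).mono fun _ hw => (oneChart 𝕜 E G).left_inv hw

/-- The Maurer-Cartan form in the chart at the identity. -/
def chartForm (z : E) : E →L[𝕜] E := Ring.inverse (chartFrame 𝕜 G z)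

theorem chartForm_chartFrame {z : E} (hu : IsUnit (chartFrame 𝕜 G z)) (a : E) :
    chartForm 𝕜 E G z (chartFrame 𝕜 G z a) = a :=
  congrArg (fun T : E →L[𝕜] E => T a) (Ring.inverse_mul_cancel _ hu)

theorem chartFrame_chartForm {z : E} (hu : IsUnit (chartFrame 𝕜 G z)) (a : E) :
    chartFrame 𝕜 G z (chartForm 𝕜 E G z a) = a :=
  congrArg (fun T : E →L[𝕜] E => T a) (Ring.mul_inverse_cancel _ hu)

theorem chartForm_one : chartForm 𝕜 E G (oneChart 𝕜 E G 1) = 1 := by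
  rw [chartForm, chartFrame_one, Ring.inverse_one]

variable [LieGroup 𝓘(𝕜, E) ∞ G]

theorem contMDiffAt_oneChart_symm {z : E} (hz : z ∈ (oneChart 𝕜 E G).target) :
    ContMDiffAt 𝓘(𝕜, E) 𝓘(𝕜, E) ∞ (oneChart 𝕜 E G).symm z :=
  (contMDiffOn_extChartAt_symm (I := 𝓘(𝕜, E)) (n := ∞) (1 : G)).contMDiffAt
    (oneChart_target_mem_nhds 𝕜 E G hz)

theorem contDiffAt_chartMul {z w : E} (hz : z ∈ (oneChart 𝕜 E G).target)
    (hw : w ∈ (oneChart 𝕜 E G).target)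
    (hzw : (oneChart 𝕜 E G).symm z * (oneChart 𝕜 E G).symm w ∈ (oneChart 𝕜 E G).source) :
    ContDiffAt 𝕜 ∞ (Function.uncurry (chartMul 𝕜 G)) (z, w) := by
  rw [← contMDiffAt_iff_contDiffAt]
  have h1 : ContMDiffAt 𝓘(𝕜, E × E) 𝓘(𝕜, E) ∞
      (fun p : E × E => (oneChart 𝕜 E G).symm p.1) (z, w) :=
    ContMDiffAt.comp (z, w) (contMDiffAt_oneChart_symm 𝕜 E G hz) contDiff_fst.contMDiff.contMDiffAt
  have h2 : ContMDiffAt 𝓘(𝕜, E × E) 𝓘(𝕜, E) ∞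
      (fun p : E × E => (oneChart 𝕜 E G).symm p.2) (z, w) :=
    ContMDiffAt.comp (z, w) (contMDiffAt_oneChart_symm 𝕜 E G hw) contDiff_snd.contMDiff.contMDiffAt
  have h3 := h1.mul h2
  rw [extChartAt_source] at hzw
  exact ContMDiffAt.comp (z, w) (contMDiffAt_extChartAt' (I := 𝓘(𝕜, E)) (n := ∞) hzw) h3

theorem contDiffAt_chartMul_one {z : E} (hz : z ∈ (oneChart 𝕜 E G).target) :
    ContDiffAt 𝕜 ∞ (Function.uncurry (chartMul 𝕜 G)) (z, oneChart 𝕜 E G 1) := by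
  refine contDiffAt_chartMul 𝕜 E G hz (mem_extChartAt_target (I := 𝓘(𝕜, E)) 1) ?_
  rw [oneChart_symm_apply_one, mul_one]
  exact (oneChart 𝕜 E G).map_target hz

theorem contDiffAt_chartFrame {z : E} (hz : z ∈ (oneChart 𝕜 E G).target) :
    ContDiffAt 𝕜 ∞ (chartFrame 𝕜 G) z :=
  (contDiffAt_chartMul_one 𝕜 E G hz).fderiv contDiffAt_const (by simp)

theorem hasFDerivAt_chartMul {z : E} (hz : z ∈ (oneChart 𝕜 E G).target) :
    HasFDerivAt (chartMul 𝕜 G z) (chartFrame 𝕜 G z) (oneChart 𝕜 E G 1) := by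
  have h : ContDiffAt 𝕜 ∞ (chartMul 𝕜 G z) (oneChart 𝕜 E G 1) :=
    ContDiffAt.comp (oneChart 𝕜 E G 1) (f := fun w => (z, w)) (contDiffAt_chartMul_one 𝕜 E G hz)
      (contDiffAt_const.prodMk contDiffAt_id)
  exact (h.differentiableAt (by simp)).hasFDerivAt

theorem isInvertible_mfderiv_oneChart_symm {z : E} (hz : z ∈ (oneChart 𝕜 E G).target) :
    (mfderiv 𝓘(𝕜, E) 𝓘(𝕜, E) (oneChart 𝕜 E G).symm z).IsInvertible := by
  have h1 := mfderivWithin_extChartAt_symm_comp_mfderiv_extChartAt (I := 𝓘(𝕜, E)) (x := (1 : G)) hz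
  have h2 := mfderiv_extChartAt_comp_mfderivWithin_extChartAt_symm (I := 𝓘(𝕜, E)) (x := (1 : G)) hz
  simp only [modelWithCornersSelf_coe, Set.range_id, mfderivWithin_univ] at h1 h2
  exact ContinuousLinearMap.IsInvertible.of_inverse h1 h2

/-- The chain rule applied to both sides of `oneChart_symm_chartMul` at the identity. -/
theorem mfderiv_oneChart_symm_comp_chartFrame [IsTopologicalGroup G] {z : E}
    (hz : z ∈ (oneChart 𝕜 E G).target) (a : E) :
    (mfderiv 𝓘(𝕜, E) 𝓘(𝕜, E) (oneChart 𝕜 E G).symm z (chartFrame 𝕜 G z a) : E) =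
      mfderiv 𝓘(𝕜, E) 𝓘(𝕜, E) (fun g => (oneChart 𝕜 E G).symm z * g) 1
        (mfderiv 𝓘(𝕜, E) 𝓘(𝕜, E) (oneChart 𝕜 E G).symm (oneChart 𝕜 E G 1) a) := by
  have he := mem_extChartAt_target (I := 𝓘(𝕜, E)) (1 : G)
  have h1 := (hasFDerivAt_chartMul 𝕜 E G hz).hasMFDerivAt
  -- The base point supplied by the chain rule is only propositionally equal to z, so the derivative
  -- is stated for every z' = z.
  have h2 : ∀ z', z' = z → HasMFDerivAt 𝓘(𝕜, E) 𝓘(𝕜, E) (oneChart 𝕜 E G).symm z'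
      (mfderiv 𝓘(𝕜, E) 𝓘(𝕜, E) (oneChart 𝕜 E G).symm z) := by
    rintro _ rfl
    exact ((contMDiffAt_oneChart_symm 𝕜 E G hz).mdifferentiableAt (by simp)).hasMFDerivAt
  have h3 : ∀ g, g = 1 → HasMFDerivAt 𝓘(𝕜, E) 𝓘(𝕜, E)
      (fun g => (oneChart 𝕜 E G).symm z * g) g
      (mfderiv 𝓘(𝕜, E) 𝓘(𝕜, E) (fun g => (oneChart 𝕜 E G).symm z * g) 1) := by
    rintro _ rfl
    exact ((contMDiff_mul_left (I := 𝓘(𝕜, E)) (n := ∞)).contMDiffAt.mdifferentiableAt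
      (by simp)).hasMFDerivAt
  have h4 := ((contMDiffAt_oneChart_symm 𝕜 E G he).mdifferentiableAt (by simp)).hasMFDerivAt
  have h5 := (h2 _ (chartMul_apply_one 𝕜 E G hz)).comp _ h1
  have h6 := (h3 _ (oneChart_symm_apply_one 𝕜 E G)).comp _ h4
  have h7 := h5.congr_of_eventuallyEq (f₁ := (fun g => (oneChart 𝕜 E G).symm z * g) ∘
    (oneChart 𝕜 E G).symm) (by
      filter_upwards [oneChart_symm_chartMul 𝕜 E G hz] with w hw using hw.symm)
  exact congrArg (fun T : E →L[𝕜] E => T a) (hasMFDerivAt_unique h7 h6)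

/-- The identification of the model space with the Lie algebra given by the chart. -/
def chartLieEquiv : E ≃ₗ[𝕜] GroupLieAlgebra 𝓘(𝕜, E) G :=
  (isInvertible_mfderiv_oneChart_symm 𝕜 E G
    (mem_extChartAt_target (I := 𝓘(𝕜, E)) (1 : G))).choose.toLinearEquiv

theorem chartLieEquiv_apply (a : E) : chartLieEquiv 𝕜 E G a =
    mfderiv 𝓘(𝕜, E) 𝓘(𝕜, E) (oneChart 𝕜 E G).symm (oneChart 𝕜 E G 1) a :=
  congrArg (fun T : E →L[𝕜] E => T a) (isInvertible_mfderiv_oneChart_symm 𝕜 E G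
    (mem_extChartAt_target (I := 𝓘(𝕜, E)) (1 : G))).choose_spec

theorem mpullback_oneChart_symm [IsTopologicalGroup G] {z : E}
    (hz : z ∈ (oneChart 𝕜 E G).target) (a : E) :
    mpullback 𝓘(𝕜, E) 𝓘(𝕜, E) (oneChart 𝕜 E G).symm
      (mulInvariantVectorField (chartLieEquiv 𝕜 E G a)) z = chartFrame 𝕜 G z a := by
  rw [mpullback_apply]
  refine (isInvertible_mfderiv_oneChart_symm 𝕜 E G hz).inverse_apply_eq.2 ?_
  refine Eq.trans ?_ (mfderiv_oneChart_symm_comp_chartFrame 𝕜 E G hz a).symm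
  rw [chartLieEquiv_apply]
  rfl

/-- The chart frame is the pullback of the invariant fields under the inverse chart. Pullback
commutes with brackets, and brackets of invariant fields are invariant. -/
theorem lieBracket_chartFrame [CompleteSpace E] [IsTopologicalGroup G] {z : E}
    (hz : z ∈ (oneChart 𝕜 E G).target) (a b : E) :
    fderiv 𝕜 (fun y => chartFrame 𝕜 G y b) z (chartFrame 𝕜 G z a) -
      fderiv 𝕜 (fun y => chartFrame 𝕜 G y a) z (chartFrame 𝕜 G z b) =
    chartFrame 𝕜 G z ((chartLieEquiv 𝕜 E G).symm
      ⁅chartLieEquiv 𝕜 E G a, chartLieEquiv 𝕜 E G b⁆) := by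
  have h1 := mpullback_mlieBracket (I := 𝓘(𝕜, E)) (I' := 𝓘(𝕜, E)) (n := ∞)
    (f := (oneChart 𝕜 E G).symm) (x₀ := z)
    (V := mulInvariantVectorField (chartLieEquiv 𝕜 E G a))
    (W := mulInvariantVectorField (chartLieEquiv 𝕜 E G b))
    (mdifferentiableAt_mulInvariantVectorField _) (mdifferentiableAt_mulInvariantVectorField _)
    (contMDiffAt_oneChart_symm 𝕜 E G hz) (by
      rw [minSmoothness_of_isRCLikeNormedField]
      exact ENat.LEInfty.out)
  rw [← mulInvariantVector_mlieBracket, ← GroupLieAlgebra.bracket_def] at h1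
  have h2 := mpullback_oneChart_symm 𝕜 E G hz ((chartLieEquiv 𝕜 E G).symm
      ⁅chartLieEquiv 𝕜 E G a, chartLieEquiv 𝕜 E G b⁆)
  rw [LinearEquiv.apply_symm_apply] at h2
  have h3 : ∀ a, mpullback 𝓘(𝕜, E) 𝓘(𝕜, E) (oneChart 𝕜 E G).symm
      (mulInvariantVectorField (chartLieEquiv 𝕜 E G a)) =ᶠ[𝓝 z] fun y => chartFrame 𝕜 G y a := by
    intro a
    filter_upwards [oneChart_target_mem_nhds 𝕜 E G hz] with y hy
    exact mpullback_oneChart_symm 𝕜 E G hy a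
  have h4 : ∀ V W : (x : E) → TangentSpace 𝓘(𝕜, E) x,
      mlieBracket 𝓘(𝕜, E) V W z = lieBracket 𝕜 V W z := by
    intro V W
    rw [← mlieBracketWithin_univ, mlieBracketWithin_eq_lieBracketWithin]
    exact congrFun (lieBracketWithin_univ (𝕜 := 𝕜) (V := V) (W := W)) z
  exact (h2.symm.trans (h1.trans (((h3 a).mlieBracket_vectorField_eq (h3 b)).trans (h4 _ _)))).symm

/-- The bracket of the Lie algebra in the chart. -/
def chartBr : E →L[𝕜] E →L[𝕜] E :=
  fderiv 𝕜 (chartFrame 𝕜 G) (oneChart 𝕜 E G 1) -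
    (fderiv 𝕜 (chartFrame 𝕜 G) (oneChart 𝕜 E G 1)).flip

theorem fderiv_chartFrame_apply {z : E} (hz : z ∈ (oneChart 𝕜 E G).target) (u b : E) :
    fderiv 𝕜 (fun y => chartFrame 𝕜 G y b) z u = fderiv 𝕜 (chartFrame 𝕜 G) z u b := by
  have h := (((contDiffAt_chartFrame 𝕜 E G hz).differentiableAt (by simp)).hasFDerivAt).clm_apply
    (hasFDerivAt_const b z)
  rw [h.fderiv]
  simp

/-- At the identity the frame is the identity operator. This exhibits the Lie bracket of the group
as a continuous bilinear map on the model space. -/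
theorem chartLieEquiv_chartBr [CompleteSpace E] [IsTopologicalGroup G] (a b : E) :
    chartLieEquiv 𝕜 E G (chartBr 𝕜 E G a b) =
      ⁅chartLieEquiv 𝕜 E G a, chartLieEquiv 𝕜 E G b⁆ := by
  have he := mem_extChartAt_target (I := 𝓘(𝕜, E)) (1 : G)
  have h := lieBracket_chartFrame 𝕜 E G he a b
  rw [fderiv_chartFrame_apply 𝕜 E G he, fderiv_chartFrame_apply 𝕜 E G he, chartFrame_one] at h
  rw [← LinearEquiv.eq_symm_apply]
  exact h

theorem fderiv_chartFrame_sub [CompleteSpace E] [IsTopologicalGroup G] {z : E}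
    (hz : z ∈ (oneChart 𝕜 E G).target) (a b : E) :
    fderiv 𝕜 (chartFrame 𝕜 G) z (chartFrame 𝕜 G z a) b -
      fderiv 𝕜 (chartFrame 𝕜 G) z (chartFrame 𝕜 G z b) a =
    chartFrame 𝕜 G z (chartBr 𝕜 E G a b) := by
  have h := lieBracket_chartFrame 𝕜 E G hz a b
  rw [fderiv_chartFrame_apply 𝕜 E G hz, fderiv_chartFrame_apply 𝕜 E G hz,
    ← chartLieEquiv_chartBr, LinearEquiv.symm_apply_apply] at h
  exact h

variable {z : E}

theorem contDiffAt_chartForm [CompleteSpace E] (hz : z ∈ (oneChart 𝕜 E G).target)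
    (hu : IsUnit (chartFrame 𝕜 G z)) : ContDiffAt 𝕜 ∞ (chartForm 𝕜 E G) z := by
  obtain ⟨U, hU⟩ := hu
  have := contDiffAt_ringInverse 𝕜 (n := ∞) U
  rw [hU] at this
  exact this.comp z (contDiffAt_chartFrame 𝕜 E G hz)

theorem eventually_isUnit_chartFrame [CompleteSpace E] :
    ∀ᶠ z in 𝓝 (oneChart 𝕜 E G 1), IsUnit (chartFrame 𝕜 G z) := by
  have hc := (contDiffAt_chartFrame 𝕜 E G
    (mem_extChartAt_target (I := 𝓘(𝕜, E)) (1 : G))).continuousAt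
  refine hc (Units.isOpen.mem_nhds ?_)
  rw [chartFrame_one]
  exact isUnit_one

/-- The Maurer-Cartan equation in the chart. -/
theorem fderiv_chartForm_sub [CompleteSpace E] [IsTopologicalGroup G]
    (hz : z ∈ (oneChart 𝕜 E G).target) (hu : ∀ᶠ y in 𝓝 z, IsUnit (chartFrame 𝕜 G y)) (u v : E) :
    fderiv 𝕜 (chartForm 𝕜 E G) z u v - fderiv 𝕜 (chartForm 𝕜 E G) z v u =
      -chartBr 𝕜 E G (chartForm 𝕜 E G z u) (chartForm 𝕜 E G z v) := by
  have huz := hu.self_of_nhds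
  -- This is the derivative of θ(X_b) = b; as the frame is invertible, u and v can then be taken to
  -- be frame vectors.
  have key : ∀ u b, fderiv 𝕜 (chartForm 𝕜 E G) z u (chartFrame 𝕜 G z b) +
      chartForm 𝕜 E G z (fderiv 𝕜 (chartFrame 𝕜 G) z u b) = 0 := by
    intro u b
    have h1 := ((contDiffAt_chartForm 𝕜 E G hz huz).differentiableAt
      (by simp)).hasFDerivAt.clm_apply ((((contDiffAt_chartFrame 𝕜 E G hz).differentiableAt
      (by simp)).hasFDerivAt).clm_apply (hasFDerivAt_const b z))
    have h2 := h1.congr_of_eventuallyEq (f₁ := fun _ => b) (by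
      filter_upwards [hu] with y hy using (chartForm_chartFrame 𝕜 E G hy b).symm)
    have h3 := congrArg (fun T : E →L[𝕜] E => T u) (h2.unique (hasFDerivAt_const b z))
    simpa [add_comm] using h3
  obtain ⟨a, rfl⟩ : ∃ a, chartFrame 𝕜 G z a = u := ⟨_, chartFrame_chartForm 𝕜 E G huz u⟩
  obtain ⟨b, rfl⟩ : ∃ b, chartFrame 𝕜 G z b = v := ⟨_, chartFrame_chartForm 𝕜 E G huz v⟩
  rw [eq_neg_of_add_eq_zero_left (key _ b), eq_neg_of_add_eq_zero_left (key _ a), neg_sub_neg,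
    ← map_sub, ← neg_sub, fderiv_chartFrame_sub 𝕜 E G hz, map_neg,
    chartForm_chartFrame 𝕜 E G huz, chartForm_chartFrame 𝕜 E G huz,
    chartForm_chartFrame 𝕜 E G huz]

/-- Left invariance of the vector fields in the chart. -/
theorem hasFDerivAt_chartMul_chartFrame [IsTopologicalGroup G] {w : E}
    (hz : z ∈ (oneChart 𝕜 E G).target) (hw : w ∈ (oneChart 𝕜 E G).target)
    (hzw : (oneChart 𝕜 E G).symm z * (oneChart 𝕜 E G).symm w ∈ (oneChart 𝕜 E G).source)
    (hu : IsUnit (chartFrame 𝕜 G w)) :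
    HasFDerivAt (chartMul 𝕜 G z)
      (chartFrame 𝕜 G (chartMul 𝕜 G z w) ∘L chartForm 𝕜 E G w) w := by
  have hd : HasFDerivAt (chartMul 𝕜 G z) (fderiv 𝕜 (chartMul 𝕜 G z) w) w := by
    have h : ContDiffAt 𝕜 ∞ (chartMul 𝕜 G z) w :=
      ContDiffAt.comp w (f := fun w => (z, w)) (contDiffAt_chartMul 𝕜 E G hz hw hzw)
        (contDiffAt_const.prodMk contDiffAt_id)
    exact (h.differentiableAt (by simp)).hasFDerivAt
  have hmem : chartMul 𝕜 G z w ∈ (oneChart 𝕜 E G).target := (oneChart 𝕜 E G).map_source hzw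
  have h1 : HasFDerivAt (chartMul 𝕜 G z ∘ chartMul 𝕜 G w)
      (fderiv 𝕜 (chartMul 𝕜 G z) w ∘L chartFrame 𝕜 G w) (oneChart 𝕜 E G 1) :=
    HasFDerivAt.comp (oneChart 𝕜 E G 1) (by rwa [chartMul_apply_one 𝕜 E G hw])
      (hasFDerivAt_chartMul 𝕜 E G hw)
  -- Associativity z(wy) = (zw)y, differentiated at y = 1.
  have h2 : chartMul 𝕜 G z ∘ chartMul 𝕜 G w =ᶠ[𝓝 (oneChart 𝕜 E G 1)]
      chartMul 𝕜 G (chartMul 𝕜 G z w) := by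
    filter_upwards [oneChart_symm_chartMul 𝕜 E G hw] with y hy
    have h3 : (oneChart 𝕜 E G).symm (chartMul 𝕜 G z w) =
      (oneChart 𝕜 E G).symm z * (oneChart 𝕜 E G).symm w := (oneChart 𝕜 E G).left_inv hzw
    rw [Function.comp_apply, chartMul, hy, chartMul, h3, mul_assoc]
  have h3 := h1.unique ((hasFDerivAt_chartMul 𝕜 E G hmem).congr_of_eventuallyEq h2)
  rw [← h3]
  convert hd using 1
  ext a
  exact congrArg _ (chartFrame_chartForm 𝕜 E G hu a)

end LieGroupChart

/-! ### From a local to a global exponential map. -/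

section GlobalExponential

open Topology Filter

variable {𝕜 L A G : Type*} [RCLike 𝕜] [NormedAddCommGroup L] [NormedSpace 𝕜 L]
  [NormedRing A] [NormedAlgebra 𝕜 A] [Group G] [TopologicalSpace G]

/-- A local inverse of `log ∘ π` is a local exponential map. -/
theorem eventually_apply_localInverse_eq_exp [CompleteSpace A] [ContinuousMul G]
    {ρ : L →L[𝕜] A} {log : A →L[𝕜] L}
    {π : G →* A} (hπ : Continuous π) (hlog : ∀ x, log (NormedSpace.exp (ρ x)) = x)
    (hinj : ∀ g x, π g = NormedSpace.exp (ρ x) → ∃ W ∈ 𝓝 g, Set.InjOn (fun h => log (π h)) W)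
    {r : L → G} (hr0 : r 0 = 1) (hr : ∀ᶠ x in 𝓝 0, ContinuousAt r x ∧ log (π (r x)) = x)
    (hcurve : ∀ x, ∃ c : ℝ → G, Tendsto c (𝓝 0) (𝓝 1) ∧
      ∀ᶠ t in 𝓝 (0 : ℝ), π (c t) = NormedSpace.exp ((t : 𝕜) • ρ x)) :
    ∀ᶠ x in 𝓝 0, π (r x) = NormedSpace.exp (ρ x) := by
  let : NormedAlgebra ℚ A := NormedAlgebra.restrictScalars ℚ 𝕜 A
  obtain ⟨ε, hε, hball⟩ := Metric.eventually_nhds_iff_ball.1 hr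
  filter_upwards [Metric.ball_mem_nhds 0 hε] with x hx
  have hmem : ∀ t ∈ Set.Icc (0 : ℝ) 1, (t : 𝕜) • x ∈ Metric.ball (0 : L) ε := by
    intro t ht
    rw [mem_ball_zero_iff] at hx ⊢
    rw [norm_smul, RCLike.norm_ofReal, abs_of_nonneg ht.1]
    exact (mul_le_of_le_one_left (norm_nonneg _) ht.2).trans_lt hx
  have hscal : Continuous fun t : ℝ => (t : 𝕜) • x :=
    RCLike.continuous_ofReal.smul continuous_const
  have hcont : ∀ t ∈ Set.Icc (0 : ℝ) 1, ContinuousAt (fun t : ℝ => r ((t : 𝕜) • x)) t :=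
    fun t ht => ContinuousAt.comp (f := fun t : ℝ => (t : 𝕜) • x)
      (hball _ (hmem t ht)).1 hscal.continuousAt
  let S : Set ℝ := {t | π (r ((t : 𝕜) • x)) = NormedSpace.exp (ρ ((t : 𝕜) • x))}
  have hexp : Continuous fun t : ℝ => NormedSpace.exp (ρ ((t : 𝕜) • x)) :=
    NormedSpace.exp_continuous.comp (ρ.continuous.comp hscal)
  have hclosed : IsClosed (S ∩ Set.Icc 0 1) := by
    rw [Set.inter_comm]
    refine IsClosed.isClosed_eq (f := fun t : ℝ => π (r ((t : 𝕜) • x))) isClosed_Icc ?_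
      hexp.continuousOn
    exact fun t ht => (hπ.continuousAt.comp (hcont t ht)).continuousWithinAt
  -- Continuity method along the segment from 0 to x: the good times form a closed set, and one can
  -- always advance to the right.
  have hsub : Set.Icc (0 : ℝ) 1 ⊆ S := by
    refine hclosed.Icc_subset_of_forall_exists_gt ?_ ?_
    · simp [S, hr0]
    rintro t ⟨htS, ht⟩ y hy
    have htI := Set.Ico_subset_Icc_self ht
    obtain ⟨W, hW, hWinj⟩ := hinj _ _ htS
    obtain ⟨c, hc, hcx⟩ := hcurve x
    have h1 : Tendsto (fun s : ℝ => t + s) (𝓝 0) (𝓝 t) := by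
      have := (continuous_const_add t).tendsto (0 : ℝ)
      rwa [add_zero] at this
    have h2 : Tendsto (fun s => r ((t : 𝕜) • x) * c s) (𝓝 0) (𝓝 (r ((t : 𝕜) • x))) := by
      have := hc.const_mul (r ((t : 𝕜) • x))
      rwa [mul_one] at this
    have h3 : ∀ᶠ s in 𝓝 (0 : ℝ), 0 < s → t + s ∈ S ∩ Set.Ioc t y := by
      filter_upwards [((hcont t htI).tendsto.comp h1) hW, h2 hW, hcx,
        h1 (Iio_mem_nhds ht.2), h1 (Iio_mem_nhds hy)] with s hs1 hs2 hs3 hs4 hs5 hs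
      have e1 : π (r ((t : 𝕜) • x) * c s) =
          NormedSpace.exp (ρ (((t + s : ℝ) : 𝕜) • x)) := by
        rw [map_mul, htS, hs3, map_smul, map_smul, ← NormedSpace.exp_add_of_commute
          (((Commute.refl (ρ x)).smul_left _).smul_right _), ← add_smul, RCLike.ofReal_add]
      -- Both points lie near r(tx) and have logarithm (t + s)x, so local injectivity of log ∘ π
      -- identifies them.
      have e2 : r (((t + s : ℝ) : 𝕜) • x) = r ((t : 𝕜) • x) * c s := by
        refine hWinj hs1 hs2 ?_
        have := (hball _ (hmem (t + s) ⟨add_nonneg ht.1 hs.le, le_of_lt hs4⟩)).2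
        simp only [Function.comp_apply, e1, hlog, this]
      refine ⟨?_, by linarith, le_of_lt hs5⟩
      change π _ = _
      rw [e2, e1]
    have h4 : ∃ᶠ s in 𝓝 (0 : ℝ), 0 < s := frequently_gt_nhds 0
    obtain ⟨s, hs, hs'⟩ := (h4.and_eventually h3).exists
    exact ⟨t + s, hs' hs⟩
  have := hsub ⟨zero_le_one, le_rfl⟩
  simpa [S] using this

/-- A local exponential map extends to a global one. -/
theorem exists_exp_of_local [CompleteSpace A] [IsTopologicalGroup G]
    {ρ : L →L[𝕜] A} {log : A →L[𝕜] L}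
    {π : G →* A}
    (hinj : ∀ g x, π g = NormedSpace.exp (ρ x) → ∃ W ∈ 𝓝 g, Set.InjOn (fun h => log (π h)) W)
    {r : L → G} (hr0 : r 0 = 1) (hr : ∀ᶠ x in 𝓝 0, ContinuousAt r x)
    (hπr : ∀ᶠ x in 𝓝 0, π (r x) = NormedSpace.exp (ρ x)) :
    ∃ E : L → G, Continuous E ∧ E 0 = 1 ∧ ∀ x, π (E x) = NormedSpace.exp (ρ x) := by
  let : NormedAlgebra ℚ A := NormedAlgebra.restrictScalars ℚ 𝕜 A
  obtain ⟨W, hW, hWinj⟩ := hinj 1 0 (by simp)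
  have hhalf : Tendsto (fun x : L => (2 : 𝕜)⁻¹ • x) (𝓝 0) (𝓝 0) := by
    have := (continuous_const_smul (2 : 𝕜)⁻¹).tendsto (0 : L)
    rwa [smul_zero] at this
  have hr1 : Tendsto r (𝓝 0) (𝓝 1) := by
    have := hr.self_of_nhds.tendsto
    rwa [hr0] at this
  have hr2 : Tendsto (fun x => r ((2 : 𝕜)⁻¹ • x) ^ 2) (𝓝 0) (𝓝 1) := by
    have := (hr1.comp hhalf).pow 2
    rwa [one_pow] at this
  -- Both sides are near 1 and have image exp ρ(x). Consequently r(2⁻ⁿx)^(2ⁿ) does not depend on n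
  -- once n is large, which defines the global map.
  have hdouble : ∀ᶠ x in 𝓝 0, r ((2 : 𝕜)⁻¹ • x) ^ 2 = r x := by
    filter_upwards [hr1 hW, hr2 hW, hπr, hhalf.eventually hπr] with x h1 h2 h3 h4
    refine hWinj h2 h1 ?_
    simp only [map_pow, h3, h4, ← NormedSpace.exp_nsmul]
    rw [← Nat.cast_smul_eq_nsmul 𝕜, ← map_smul, smul_smul]
    simp
  obtain ⟨ε, hε, hball⟩ := Metric.eventually_nhds_iff_ball.1 ((hr.and hπr).and hdouble)
  have hscale : ∀ (n : ℕ) (x : L), ‖x‖ < 2 ^ n * ε →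
      ((2 : 𝕜) ^ n)⁻¹ • x ∈ Metric.ball (0 : L) ε := by
    intro n x hx
    rw [mem_ball_zero_iff, norm_smul, norm_inv, norm_pow, RCLike.norm_ofNat]
    exact (inv_mul_lt_iff₀ (by positivity)).2 hx
  have hpow : ∀ (k n : ℕ) (x : L), ‖x‖ < 2 ^ n * ε →
      r (((2 : 𝕜) ^ (n + k))⁻¹ • x) ^ 2 ^ (n + k) = r (((2 : 𝕜) ^ n)⁻¹ • x) ^ 2 ^ n := by
    intro k
    induction k with
    | zero => intro n x _; rfl
    | succ k ih =>
      intro n x hx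
      have hx' : ‖x‖ < 2 ^ (n + k) * ε := hx.trans_le
        (mul_le_mul_of_nonneg_right (pow_le_pow_right₀ one_le_two (Nat.le_add_right n k)) hε.le)
      rw [← ih n x hx, ← (hball _ (hscale _ x hx')).2, smul_smul, ← mul_inv, ← pow_succ',
        ← pow_mul, ← pow_succ', add_assoc]
  have hpow' : ∀ (n m : ℕ) (x : L), ‖x‖ < 2 ^ n * ε → ‖x‖ < 2 ^ m * ε →
      r (((2 : 𝕜) ^ n)⁻¹ • x) ^ 2 ^ n = r (((2 : 𝕜) ^ m)⁻¹ • x) ^ 2 ^ m := by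
    intro n m x hn hm
    rw [← hpow m n x hn, ← hpow n m x hm, add_comm]
  have hn : ∀ x : L, ∃ n : ℕ, ‖x‖ < 2 ^ n * ε := by
    intro x
    obtain ⟨n, hn⟩ := pow_unbounded_of_one_lt (‖x‖ / ε) (one_lt_two (α := ℝ))
    exact ⟨n, (div_lt_iff₀ hε).1 hn⟩
  choose n hn using hn
  refine ⟨fun x => r (((2 : 𝕜) ^ n x)⁻¹ • x) ^ 2 ^ n x, ?_, ?_, ?_⟩
  · rw [continuous_iff_continuousAt]
    intro x
    have h1 : ContinuousAt (fun y => r (((2 : 𝕜) ^ n x)⁻¹ • y) ^ 2 ^ n x) x :=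
      (ContinuousAt.comp (f := fun y : L => ((2 : 𝕜) ^ n x)⁻¹ • y)
        (hball _ (hscale _ x (hn x))).1.1 (continuous_const_smul _).continuousAt).pow _
    refine h1.congr ?_
    filter_upwards [(isOpen_lt continuous_norm continuous_const).mem_nhds (hn x)] with y hy
    exact hpow' _ _ y hy (hn y)
  · simp [hr0]
  · intro x
    rw [map_pow, (hball _ (hscale _ x (hn x))).1.2, ← NormedSpace.exp_nsmul,
      ← Nat.cast_smul_eq_nsmul 𝕜, ← map_smul, smul_smul]
    simp

/-- A homomorphism with locally injective logarithm on a connected group is injective. -/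
theorem injective_of_exp [IsTopologicalGroup G] [T2Space G] [PreconnectedSpace G]
    {ρ : L →L[𝕜] A} {log : A →L[𝕜] L}
    {π : G →* A} (hπ : Continuous π) (hlog : ∀ x, log (NormedSpace.exp (ρ x)) = x)
    (hinj : ∀ g x, π g = NormedSpace.exp (ρ x) → ∃ W ∈ 𝓝 g, Set.InjOn (fun h => log (π h)) W)
    {E : L → G} (hE : Continuous E) (hE0 : E 0 = 1)
    (hπE : ∀ x, π (E x) = NormedSpace.exp (ρ x)) :
    Function.Injective π ∧ ∀ g, ∃ x, π g = NormedSpace.exp (ρ x) := by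
  have hcont : Continuous fun g => E (log (π g)) := hE.comp (log.continuous.comp hπ)
  have hlog1 : log 1 = 0 := by
    have := hlog 0
    rwa [map_zero, NormedSpace.exp_zero] at this
  -- Closed because G is Hausdorff; open because h and E(log π(h)) have the same logarithm and are
  -- both near g.
  have hclopen : IsClopen {g | E (log (π g)) = g} := by
    refine ⟨isClosed_eq hcont continuous_id, isOpen_iff_mem_nhds.2 fun g hg => ?_⟩
    change E (log (π g)) = g at hg
    obtain ⟨W, hW, hWinj⟩ := hinj g (log (π g)) (by rw [← hπE, hg])
    have h1 : Tendsto (fun g => E (log (π g))) (𝓝 g) (𝓝 g) := by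
      have := hcont.tendsto g
      rwa [hg] at this
    filter_upwards [hW, h1 hW] with h hh hh'
    refine hWinj hh' hh ?_
    simp only [hπE, hlog]
  have huniv := hclopen.eq_univ ⟨1, by simp [hlog1, hE0]⟩
  have hall : ∀ g, E (log (π g)) = g := fun g =>
    (huniv ▸ Set.mem_univ g : g ∈ {g | E (log (π g)) = g})
  refine ⟨fun g h hgh => ?_, fun g => ⟨log (π g), ?_⟩⟩
  · rw [← hall g, hgh, hall]
  · rw [← hπE, hall]

end GlobalExponential

/-! ### Uniqueness for the flat equation and the integrated homomorphism. -/

section FlatUniqueness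

open Metric

/-- Two solutions of the flat equation differ by a constant. -/
theorem mul_inverse_eq_of_flat {𝕜 E A : Type*} [RCLike 𝕜] [NormedAddCommGroup E] [NormedSpace 𝕜 E]
    [NormedRing A] [NormedAlgebra 𝕜 A] [CompleteSpace A] {e : E} {r : ℝ} {σ : E → E →L[𝕜] A}
    {f P : E → A}
    (hf : ∀ z ∈ ball e r, HasFDerivAt f (ContinuousLinearMap.mul 𝕜 A (f z) ∘L σ z) z)
    (hP : ∀ z ∈ ball e r, HasFDerivAt P (ContinuousLinearMap.mul 𝕜 A (P z) ∘L σ z) z)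
    (hu : ∀ z ∈ ball e r, IsUnit (P z)) {z : E} (hz : z ∈ ball e r) :
    f z * Ring.inverse (P z) = f e * Ring.inverse (P e) := by
  refine eqOn_ball_of_hasFDerivAt (f := fun z => f z * Ring.inverse (P z))
    (g := fun _ => f e * Ring.inverse (P e)) (f' := fun _ => (0 : E →L[𝕜] A)) (fun z hz => ?_)
    (fun z _ => hasFDerivAt_const _ _) rfl hz
  obtain ⟨p, hp⟩ := hu z hz
  have h1 := hasFDerivAt_ringInverse (𝕜 := 𝕜) p
  rw [hp] at h1
  -- d(f P⁻¹) = f σ P⁻¹ - f P⁻¹ (P σ) P⁻¹ = 0.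
  refine ((hf z hz).mul' (h1.comp z (hP z hz))).congr_fderiv ?_
  ext u
  simp [← hp, mul_assoc]

end FlatUniqueness

noncomputable section LocalHomomorphism

open Topology Filter Metric

variable {𝕜 E G F : Type*} [RCLike 𝕜] [NormedAddCommGroup E] [NormedSpace 𝕜 E]
  [TopologicalSpace G] [ChartedSpace E G] [Group G] [LieGroup 𝓘(𝕜, E) ∞ G]
  [NormedAddCommGroup F] [NormedSpace 𝕜 F] [CompleteSpace F]

/-- A representation of the Lie algebra integrates to the chart at the identity. -/
theorem NilpotentRep.exists_chart_flat [CompleteSpace E] [IsTopologicalGroup G] {N : ℕ}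
    {B : NilpotentBracket 𝕜 E N}
    (R : NilpotentRep B F) (hB : B.br = chartBr 𝕜 E G) :
    ∃ r > 0, ∃ P : E → (F →L[𝕜] F), P (oneChart 𝕜 E G 1) = 1 ∧
      ball (oneChart 𝕜 E G 1) r ⊆ (oneChart 𝕜 E G).target ∧
      (∀ z ∈ ball (oneChart 𝕜 E G 1) r, IsUnit (chartFrame 𝕜 G z)) ∧
      (∀ z ∈ ball (oneChart 𝕜 E G 1) r, IsUnit (P z)) ∧
      ∀ z ∈ ball (oneChart 𝕜 E G 1) r, HasFDerivAt P
        (ContinuousLinearMap.mul 𝕜 (F →L[𝕜] F) (P z) ∘L R.rep ∘L chartForm 𝕜 E G z) z := by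
  have he := mem_extChartAt_target (I := 𝓘(𝕜, E)) (1 : G)
  obtain ⟨r, hr, hball⟩ := Metric.eventually_nhds_iff_ball.1
    (Filter.Eventually.and (oneChart_target_mem_nhds 𝕜 E G he) (eventually_isUnit_chartFrame 𝕜 E G))
  obtain ⟨P, hP1, hP⟩ := R.exists_flat (oneChart 𝕜 E G 1) r (chartForm 𝕜 E G)
    (fderiv 𝕜 (chartForm 𝕜 E G))
    (fun z hz => ((contDiffAt_chartForm 𝕜 E G (hball z hz).1 (hball z hz).2).differentiableAt
      (by simp)).hasFDerivAt)
    (fun z hz u v => by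
      rw [hB]
      exact fderiv_chartForm_sub 𝕜 E G (hball z hz).1
        (Filter.mem_of_superset (isOpen_ball.mem_nhds hz) fun y hy => (hball y hy).2) u v)
  have hPu : ∀ᶠ z in 𝓝 (oneChart 𝕜 E G 1), IsUnit (P z) := by
    refine (hP _ (mem_ball_self hr)).continuousAt (Units.isOpen.mem_nhds ?_)
    rw [hP1]
    exact isUnit_one
  obtain ⟨s, hs, hball'⟩ := Metric.eventually_nhds_iff_ball.1 hPu
  have h1 : ball (oneChart 𝕜 E G 1) (min r s) ⊆ ball (oneChart 𝕜 E G 1) r :=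
    ball_subset_ball (min_le_left _ _)
  exact ⟨min r s, lt_min hr hs, P, hP1, fun z hz => (hball z (h1 hz)).1,
    fun z hz => (hball z (h1 hz)).2,
    fun z hz => hball' z (ball_subset_ball (min_le_right _ _) hz), fun z hz => hP z (h1 hz)⟩

section

variable {ρ : E →L[𝕜] F →L[𝕜] F} {r : ℝ} {P : E → (F →L[𝕜] F)}

/-- By left invariance of θ, the map w ↦ P(zw) solves the same flat equation as P, so P(zw) P(w)⁻¹
is constant; at w = 1 it equals P(z). -/
theorem eventually_apply_chartMul [IsTopologicalGroup G] (hr : 0 < r)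
    (hP1 : P (oneChart 𝕜 E G 1) = 1)
    (ht : ball (oneChart 𝕜 E G 1) r ⊆ (oneChart 𝕜 E G).target)
    (hX : ∀ z ∈ ball (oneChart 𝕜 E G 1) r, IsUnit (chartFrame 𝕜 G z))
    (hPu : ∀ z ∈ ball (oneChart 𝕜 E G 1) r, IsUnit (P z))
    (hP : ∀ z ∈ ball (oneChart 𝕜 E G 1) r, HasFDerivAt P
        (ContinuousLinearMap.mul 𝕜 (F →L[𝕜] F) (P z) ∘L ρ ∘L chartForm 𝕜 E G z) z)
    {z : E} (hz : z ∈ ball (oneChart 𝕜 E G 1) r) :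
    ∀ᶠ w in 𝓝 (oneChart 𝕜 E G 1), P (chartMul 𝕜 G z w) = P z * P w := by
  have hc : ContinuousAt (chartMul 𝕜 G z) (oneChart 𝕜 E G 1) :=
    (hasFDerivAt_chartMul 𝕜 E G (ht hz)).continuousAt
  have hmem : ∀ᶠ w in 𝓝 (oneChart 𝕜 E G 1), chartMul 𝕜 G z w ∈ ball (oneChart 𝕜 E G 1) r := by
    refine hc (isOpen_ball.mem_nhds ?_)
    rwa [chartMul_apply_one 𝕜 E G (ht hz)]
  obtain ⟨s, hs, hball⟩ := Metric.eventually_nhds_iff_ball.1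
    ((hmem.and (eventually_chartMul_mem_source 𝕜 E G (ht hz))).and (ball_mem_nhds _ hr))
  filter_upwards [ball_mem_nhds _ hs] with w hw
  have h := mul_inverse_eq_of_flat (f := fun w => P (chartMul 𝕜 G z w)) (P := P)
    (σ := fun w => ρ ∘L chartForm 𝕜 E G w) (e := oneChart 𝕜 E G 1) (r := s) (fun w hw => ?_)
    (fun w hw => hP w (hball w hw).2) (fun w hw => hPu w (hball w hw).2) hw
  · simp only [chartMul_apply_one 𝕜 E G (ht hz), hP1, Ring.inverse_one, mul_one] at h
    rw [← h, mul_assoc, Ring.inverse_mul_cancel _ (hPu w (hball w hw).2), mul_one]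
  · obtain ⟨⟨h1, h2⟩, h3⟩ := hball w hw
    refine ((hP _ h1).comp w (hasFDerivAt_chartMul_chartFrame 𝕜 E G (ht hz) (ht h3) h2
      (hX w h3))).congr_fderiv ?_
    ext1 u
    simp [chartForm_chartFrame 𝕜 E G (hX _ h1)]

/-- On a simply connected group the local homomorphism given by a flat section extends. -/
theorem exists_monoidHom_of_chart_flat [IsTopologicalGroup G] [SimplyConnectedSpace G]
    (hr : 0 < r) (hP1 : P (oneChart 𝕜 E G 1) = 1)
    (ht : ball (oneChart 𝕜 E G 1) r ⊆ (oneChart 𝕜 E G).target)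
    (hX : ∀ z ∈ ball (oneChart 𝕜 E G 1) r, IsUnit (chartFrame 𝕜 G z))
    (hPu : ∀ z ∈ ball (oneChart 𝕜 E G 1) r, IsUnit (P z))
    (hP : ∀ z ∈ ball (oneChart 𝕜 E G 1) r, HasFDerivAt P
        (ContinuousLinearMap.mul 𝕜 (F →L[𝕜] F) (P z) ∘L ρ ∘L chartForm 𝕜 E G z) z) :
    ∃ φ : G →* (F →L[𝕜] F), Continuous φ ∧ ∀ᶠ g in 𝓝 (1 : G), φ g = P (oneChart 𝕜 E G g) := by
  classical
  let : NormedSpace ℝ E := .restrictScalars ℝ 𝕜 E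
  have : LocallyPathConnectedSpace G := ChartedSpace.locallyPathConnectedSpace E G
  let f : G → (F →L[𝕜] F)ˣ := fun g =>
    if h : IsUnit (P (oneChart 𝕜 E G g)) then h.unit else 1
  have hf : ∀ g, IsUnit (P (oneChart 𝕜 E G g)) → (f g : F →L[𝕜] F) = P (oneChart 𝕜 E G g) := by
    intro g hg
    simp only [f, dif_pos hg, IsUnit.unit_spec]
  have hcont : ContinuousAt (oneChart 𝕜 E G) 1 := continuousAt_extChartAt (I := 𝓘(𝕜, E)) (1 : G)
  have hnear : ∀ᶠ g in 𝓝 (1 : G), oneChart 𝕜 E G g ∈ ball (oneChart 𝕜 E G 1) r :=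
    hcont (ball_mem_nhds _ hr)
  have hsource : ∀ᶠ g in 𝓝 (1 : G), g ∈ (oneChart 𝕜 E G).source :=
    extChartAt_source_mem_nhds (I := 𝓘(𝕜, E)) (1 : G)
  let U : Set G := (oneChart 𝕜 E G).source ∩ oneChart 𝕜 E G ⁻¹' ball (oneChart 𝕜 E G 1) r
  have hU : IsOpen U := (continuousOn_extChartAt (I := 𝓘(𝕜, E)) (1 : G)).isOpen_inter_preimage
    (isOpen_extChartAt_source (I := 𝓘(𝕜, E)) (1 : G)) isOpen_ball
  have h1U : (1 : G) ∈ U := ⟨mem_extChartAt_source (I := 𝓘(𝕜, E)) (1 : G), mem_ball_self hr⟩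
  obtain ⟨φ, hφ⟩ := exists_monoidHom_of_local U hU h1U f (by
    rintro a ⟨ha, ha'⟩
    have hau : ∀ᶠ u in 𝓝 (1 : G), a * u ∈ U := by
      have := (continuous_const_mul a).tendsto (1 : G)
      rw [mul_one] at this
      exact this (hU.mem_nhds ⟨ha, ha'⟩)
    filter_upwards [hnear, hsource, hau, hcont.eventually
      (eventually_apply_chartMul hr hP1 ht hX hPu hP ha')] with u h1 h2 h3 h4
    have h5 : chartMul 𝕜 G (oneChart 𝕜 E G a) (oneChart 𝕜 E G u) = oneChart 𝕜 E G (a * u) := by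
      rw [chartMul, (oneChart 𝕜 E G).left_inv ha, (oneChart 𝕜 E G).left_inv h2]
    ext1
    rw [Units.val_mul, hf _ (hPu _ h1), hf _ (hPu _ ha'), hf _ (hPu _ h3.2), ← h4, h5])
  have hφP : ∀ᶠ g in 𝓝 (1 : G), ((Units.coeHom (F →L[𝕜] F)).comp φ) g = P (oneChart 𝕜 E G g) := by
    filter_upwards [hφ, hnear] with g h1 h2
    rw [← hf _ (hPu _ h2), ← h1]
    rfl
  refine ⟨(Units.coeHom _).comp φ, ?_, hφP⟩
  refine continuous_of_continuousAt_one _ ?_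
  have h1 : ContinuousAt (fun g => P (oneChart 𝕜 E G g)) 1 :=
    ContinuousAt.comp (hP _ (mem_ball_self hr)).continuousAt hcont
  exact h1.congr (hφP.mono fun _ h => h.symm)

end

end LocalHomomorphism

/-! ### Local logarithm and one-parameter subgroups. -/

noncomputable section LocalExponential

open Topology Filter Metric

variable {𝕜 E G F : Type*} [RCLike 𝕜] [NormedAddCommGroup E] [NormedSpace 𝕜 E] [CompleteSpace E]
  [TopologicalSpace G] [ChartedSpace E G] [Group G] [LieGroup 𝓘(𝕜, E) ∞ G]
  [NormedAddCommGroup F] [NormedSpace 𝕜 F] {r : ℝ} {P : E → (F →L[𝕜] F)}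

/-- At the identity P and θ are both 1, so the derivative is the invertible map of `log_exp_mul`.
Strictness, needed for the inverse function theorem, follows from continuity of the derivative. -/
theorem NilpotentRep.exists_hasStrictFDerivAt_log {N : ℕ} {B : NilpotentBracket 𝕜 E N}
    (R : NilpotentRep B F) (hr : 0 < r) (hP1 : P (oneChart 𝕜 E G 1) = 1)
    (hP : ∀ z ∈ ball (oneChart 𝕜 E G 1) r, HasFDerivAt P
        (ContinuousLinearMap.mul 𝕜 (F →L[𝕜] F) (P z) ∘L R.rep ∘L chartForm 𝕜 E G z) z) (x : E) :
    ∃ e : E ≃L[𝕜] E, HasStrictFDerivAt (fun z => R.log (NormedSpace.exp (R.rep x) * P z))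
      (e : E →L[𝕜] E) (oneChart 𝕜 E G 1) := by
  obtain ⟨e, he⟩ := R.log_exp_mul x
  refine ⟨e, ?_⟩
  let T : (F →L[𝕜] F) →L[𝕜] E :=
    R.log ∘L ContinuousLinearMap.mul 𝕜 (F →L[𝕜] F) (NormedSpace.exp (R.rep x))
  have h1 : ∀ᶠ z in 𝓝 (oneChart 𝕜 E G 1), HasFDerivAt (fun z => T (P z)) (T ∘L
      (ContinuousLinearMap.mul 𝕜 (F →L[𝕜] F) (P z) ∘L R.rep ∘L chartForm 𝕜 E G z)) z := by
    filter_upwards [ball_mem_nhds _ hr] with z hz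
    exact T.hasFDerivAt.comp z (hP z hz)
  have hθ : ContinuousAt (chartForm 𝕜 E G) (oneChart 𝕜 E G 1) :=
    (contDiffAt_chartForm 𝕜 E G (mem_extChartAt_target (I := 𝓘(𝕜, E)) (1 : G))
      (by rw [chartFrame_one]; exact isUnit_one)).continuousAt
  have h2 : ContinuousAt (fun z => T ∘L (ContinuousLinearMap.mul 𝕜 (F →L[𝕜] F) (P z) ∘L
      R.rep ∘L chartForm 𝕜 E G z)) (oneChart 𝕜 E G 1) :=
    continuousAt_const.clm_comp
      (((ContinuousLinearMap.mul 𝕜 (F →L[𝕜] F)).continuous.continuousAt.comp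
        (hP _ (mem_ball_self hr)).continuousAt).clm_comp (continuousAt_const.clm_comp hθ))
  have h3 := hasStrictFDerivAt_of_hasFDerivAt_of_continuousAt h1 h2
  refine h3.congr_fderiv ?_
  rw [hP1, chartForm_one]
  ext u
  simp [T, he]

/-- The logarithm of the homomorphism is locally injective. -/
theorem NilpotentRep.exists_injOn_log [IsTopologicalGroup G] {N : ℕ} {B : NilpotentBracket 𝕜 E N}
    (R : NilpotentRep B F) (hr : 0 < r) (hP1 : P (oneChart 𝕜 E G 1) = 1)
    (hP : ∀ z ∈ ball (oneChart 𝕜 E G 1) r, HasFDerivAt P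
        (ContinuousLinearMap.mul 𝕜 (F →L[𝕜] F) (P z) ∘L R.rep ∘L chartForm 𝕜 E G z) z)
    {φ : G →* (F →L[𝕜] F)} (hφ : ∀ᶠ g in 𝓝 (1 : G), φ g = P (oneChart 𝕜 E G g)) (g : G) (x : E)
    (hg : φ g = NormedSpace.exp (R.rep x)) :
    ∃ W ∈ 𝓝 g, Set.InjOn (fun h => R.log (φ h)) W := by
  obtain ⟨e, he⟩ := R.exists_hasStrictFDerivAt_log hr hP1 hP x
  let Φ := he.toOpenPartialHomeomorph _
  have hcont : ContinuousAt (oneChart 𝕜 E G) 1 := continuousAt_extChartAt (I := 𝓘(𝕜, E)) (1 : G)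
  have h1 : ∀ᶠ u in 𝓝 (1 : G), oneChart 𝕜 E G u ∈ Φ.source :=
    hcont (Φ.open_source.mem_nhds he.mem_toOpenPartialHomeomorph_source)
  have h2 : ∀ᶠ u in 𝓝 (1 : G), u ∈ (oneChart 𝕜 E G).source :=
    extChartAt_source_mem_nhds (I := 𝓘(𝕜, E)) (1 : G)
  refine ⟨_, (tendsto_inv_mul_nhds_one g).eventually ((h1.and h2).and hφ), ?_⟩
  rintro a ⟨⟨ha1, ha2⟩, ha3⟩ b ⟨⟨hb1, hb2⟩, hb3⟩ hab
  -- Left translation by g⁻¹ moves the question to the identity: φ(a) = exp(ρ(x)) φ(g⁻¹a).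
  have key : ∀ a, φ (g⁻¹ * a) = P (oneChart 𝕜 E G (g⁻¹ * a)) →
      R.log (φ a) = Φ (oneChart 𝕜 E G (g⁻¹ * a)) := by
    intro a ha
    change _ = R.log (NormedSpace.exp (R.rep x) * P (oneChart 𝕜 E G (g⁻¹ * a)))
    rw [← ha, ← hg, ← map_mul, mul_inv_cancel_left]
  simp only [key a ha3, key b hb3] at hab
  exact mul_left_cancel ((oneChart 𝕜 E G).injOn ha2 hb2 (Φ.injOn ha1 hb1 hab))

/-- The logarithm of the homomorphism has a local inverse. -/
theorem NilpotentRep.exists_localInverse_log {N : ℕ} {B : NilpotentBracket 𝕜 E N}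
    (R : NilpotentRep B F) (hr : 0 < r) (hP1 : P (oneChart 𝕜 E G 1) = 1)
    (ht : ball (oneChart 𝕜 E G 1) r ⊆ (oneChart 𝕜 E G).target)
    (hP : ∀ z ∈ ball (oneChart 𝕜 E G 1) r, HasFDerivAt P
        (ContinuousLinearMap.mul 𝕜 (F →L[𝕜] F) (P z) ∘L R.rep ∘L chartForm 𝕜 E G z) z)
    {φ : G →* (F →L[𝕜] F)} (hφ : ∀ᶠ g in 𝓝 (1 : G), φ g = P (oneChart 𝕜 E G g)) :
    ∃ q : E → G, q 0 = 1 ∧ ∀ᶠ x in 𝓝 0, ContinuousAt q x ∧ R.log (φ (q x)) = x := by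
  obtain ⟨e, he⟩ := R.exists_hasStrictFDerivAt_log hr hP1 hP 0
  let Φ := he.toOpenPartialHomeomorph _
  have hΦ : ∀ z, Φ z = R.log (P z) := by
    intro z
    change R.log (NormedSpace.exp (R.rep 0) * P z) = _
    rw [map_zero, NormedSpace.exp_zero, one_mul]
  have hs : oneChart 𝕜 E G 1 ∈ Φ.source := he.mem_toOpenPartialHomeomorph_source
  have hΦ1 : Φ (oneChart 𝕜 E G 1) = 0 := by
    rw [hΦ, hP1, ← NormedSpace.exp_zero, ← map_zero R.rep, R.log_exp]
  have h0 : (0 : E) ∈ Φ.target := hΦ1 ▸ Φ.map_source hs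
  have hsymm0 : Φ.symm 0 = oneChart 𝕜 E G 1 := by rw [← hΦ1, Φ.left_inv hs]
  have hc : Tendsto Φ.symm (𝓝 0) (𝓝 (oneChart 𝕜 E G 1)) := by
    rw [← hsymm0]
    exact Φ.continuousAt_symm h0
  have hc' : Tendsto (oneChart 𝕜 E G).symm (𝓝 (oneChart 𝕜 E G 1)) (𝓝 1) := by
    have := continuousAt_extChartAt_symm (I := 𝓘(𝕜, E)) (1 : G)
    rwa [ContinuousAt, oneChart_symm_apply_one] at this
  refine ⟨fun x => (oneChart 𝕜 E G).symm (Φ.symm x), by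
    simp only [hsymm0, oneChart_symm_apply_one], ?_⟩
  filter_upwards [Φ.open_target.mem_nhds h0, hc (ball_mem_nhds _ hr), (hc'.comp hc).eventually hφ]
    with x h1 h2 h3
  constructor
  · exact ContinuousAt.comp (continuousAt_extChartAt_symm'' (I := 𝓘(𝕜, E)) (ht h2))
      (Φ.continuousAt_symm h1)
  · simp only [Function.comp_apply] at h3
    rw [h3, (oneChart 𝕜 E G).right_inv (ht h2), ← hΦ, Φ.right_inv h1]

/-- One-parameter subgroups. -/
theorem exists_curve_of_chart_flat [CompleteSpace F] {ρ : E →L[𝕜] F →L[𝕜] F}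
    (hr : 0 < r) (hP1 : P (oneChart 𝕜 E G 1) = 1)
    (ht : ball (oneChart 𝕜 E G 1) r ⊆ (oneChart 𝕜 E G).target)
    (hX : ∀ z ∈ ball (oneChart 𝕜 E G 1) r, IsUnit (chartFrame 𝕜 G z))
    (hP : ∀ z ∈ ball (oneChart 𝕜 E G 1) r, HasFDerivAt P
        (ContinuousLinearMap.mul 𝕜 (F →L[𝕜] F) (P z) ∘L ρ ∘L chartForm 𝕜 E G z) z)
    {φ : G →* (F →L[𝕜] F)} (hφ : ∀ᶠ g in 𝓝 (1 : G), φ g = P (oneChart 𝕜 E G g)) (x : E) :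
    ∃ c : ℝ → G, Tendsto c (𝓝 0) (𝓝 1) ∧
      ∀ᶠ t in 𝓝 (0 : ℝ), φ (c t) = NormedSpace.exp ((t : 𝕜) • ρ x) := by
  let : NormedSpace ℝ E := .restrictScalars ℝ 𝕜 E
  let : NormedAlgebra ℝ (F →L[𝕜] F) := .restrictScalars ℝ 𝕜 (F →L[𝕜] F)
  let : NormedAlgebra ℚ (F →L[𝕜] F) := .restrictScalars ℚ 𝕜 (F →L[𝕜] F)
  have he := mem_extChartAt_target (I := 𝓘(𝕜, E)) (1 : G)
  have hX1 : ContDiffAt ℝ 1 (fun z => chartFrame 𝕜 G z x) (oneChart 𝕜 E G 1) := by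
    have : ContDiffAt 𝕜 1 (fun z => chartFrame 𝕜 G z x) (oneChart 𝕜 E G 1) :=
      ((contDiffAt_chartFrame 𝕜 E G he).of_le (by simp)).clm_apply contDiffAt_const
    exact this.restrict_scalars ℝ
  -- An integral curve of the left-invariant field of x through the identity, in real time also when
  -- 𝕜 is ℂ.
  obtain ⟨α, hα0, ε, hε, hα⟩ :=
    hX1.exists_forall_mem_closedBall_exists_eq_forall_mem_Ioo_hasDerivAt₀ 0
  have hαc : Tendsto α (𝓝 0) (𝓝 (oneChart 𝕜 E G 1)) := by
    rw [← hα0]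
    exact (hα 0 ⟨by linarith, by linarith⟩).continuousAt
  have hc' : Tendsto (oneChart 𝕜 E G).symm (𝓝 (oneChart 𝕜 E G 1)) (𝓝 1) := by
    have := continuousAt_extChartAt_symm (I := 𝓘(𝕜, E)) (1 : G)
    rwa [ContinuousAt, oneChart_symm_apply_one] at this
  refine ⟨fun t => (oneChart 𝕜 E G).symm (α t), hc'.comp hαc, ?_⟩
  obtain ⟨δ, hδ, hball⟩ := Metric.eventually_nhds_iff_ball.1
    (Filter.Eventually.and (Ioo_mem_nhds (show (0 : ℝ) - ε < 0 by linarith)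
      (show (0 : ℝ) < 0 + ε by linarith)) (hαc (ball_mem_nhds _ hr)))
  filter_upwards [ball_mem_nhds 0 hδ, (hc'.comp hαc).eventually hφ] with t htδ h2
  have hu : ∀ t : ℝ, IsUnit (NormedSpace.exp (t • ρ x)) := fun t => NormedSpace.isUnit_exp _
  -- P ∘ α and t ↦ exp(tρ(x)) both solve f' = f ρ(x) with value 1 at 0.
  have h := mul_inverse_eq_of_flat (𝕜 := ℝ) (A := F →L[𝕜] F) (e := (0 : ℝ)) (r := δ)
    (f := fun t => P (α t)) (P := fun t => NormedSpace.exp (t • ρ x))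
    (σ := fun _ => ContinuousLinearMap.toSpanSingleton ℝ (ρ x)) (fun t ht' => ?_) (fun t _ => ?_)
    (fun t _ => hu t) htδ
  · simp only [hα0, hP1, zero_smul, NormedSpace.exp_zero, Ring.inverse_one, mul_one] at h
    simp only [Function.comp_apply] at h2
    rw [h2, (oneChart 𝕜 E G).right_inv (ht (hball t htδ).2)]
    calc P (α t) = P (α t) * Ring.inverse (NormedSpace.exp (t • ρ x)) *
          NormedSpace.exp (t • ρ x) := by
            rw [mul_assoc, Ring.inverse_mul_cancel _ (hu t), mul_one]
      _ = NormedSpace.exp (t • ρ x) := by rw [h, one_mul]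
      _ = _ := rfl
  · obtain ⟨h1, h3⟩ := hball t ht'
    have h4 := ((hP _ h3).restrictScalars ℝ).comp_hasDerivAt t (hα t h1)
    have h5 := h4.hasFDerivAt
    refine h5.congr_fderiv ?_
    ext
    simp [chartForm_chartFrame 𝕜 E G (hX _ h3)]
  · have h4 := (hasDerivAt_exp_smul_const (𝕂 := ℝ) (ρ x) t).hasFDerivAt
    refine h4.congr_fderiv ?_
    ext
    simp

end LocalExponential

/-! ### Unipotence and the final theorem. -/

theorem NormedSpace.exp_sub_one_pow_eq_zero (𝕜 : Type*) {A : Type*} [RCLike 𝕜] [NormedRing A]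
    [NormedAlgebra 𝕜 A] [CompleteSpace A] {a : A} {n : ℕ} (ha : a ^ (n + 1) = 0) :
    (NormedSpace.exp a - 1) ^ (n + 1) = 0 := by
  let s : A := ∑ k ∈ Finset.range n, (((k + 1).factorial : 𝕜)⁻¹) • a ^ k
  have h1 : NormedSpace.exp a - 1 = a * s := by
    rw [NormedSpace.exp_eq_sum_of_pow_eq_zero 𝕜 ha, Finset.sum_range_succ', Finset.mul_sum]
    simp [pow_succ']
  have h2 : Commute a s := Commute.sum_right _ _ _ fun k _ =>
    ((Commute.refl a).pow_right k).smul_right _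
  rw [h1, h2.mul_pow, ha, zero_mul]

/-- Simply connected nilpotent Banach-Lie groups have faithful unipotent representations. -/
theorem exists_faithful_monoidHom_of_lowerCentralSeries_eq_bot {𝕜 : Type u} [RCLike 𝕜] (N : ℕ)
    (E : Type v) [NormedAddCommGroup E] [NormedSpace 𝕜 E] [CompleteSpace E]
    (G : Type w) [TopologicalSpace G] [ChartedSpace E G] [Group G] [LieGroup 𝓘(𝕜, E) ∞ G]
    [SimplyConnectedSpace G]
    (hN : LieModule.lowerCentralSeries 𝕜 (GroupLieAlgebra 𝓘(𝕜, E) G)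
      (GroupLieAlgebra 𝓘(𝕜, E) G) N = ⊥) :
    ∃ (F : Type (max u v)) (_ : NormedAddCommGroup F) (_ : NormedSpace 𝕜 F)
      (_ : CompleteSpace F) (ρ : G →* (F →L[𝕜] F)),
      Function.Injective ρ ∧ Continuous ρ ∧
      ∀ x : G, (ρ x - 1) ^ (2 ^ (N - 1) * N + 1) = 0 := by
  have : IsTopologicalGroup G := topologicalGroup_of_lieGroup 𝓘(𝕜, E) ∞
  -- In a topological group T1 implies Hausdorff, as `injective_of_exp` requires.
  have : T1Space G := ChartedSpace.t1Space E G
  let B : NilpotentBracket 𝕜 E N := NilpotentBracket.ofLieAlgebra (chartLieEquiv 𝕜 E G)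
    (chartBr 𝕜 E G) (chartLieEquiv_chartBr 𝕜 E G) hN
  let R := B.nilpotentRep
  obtain ⟨r, hr, P, hP1, ht, hX, hPu, hP⟩ := R.exists_chart_flat (G := G) rfl
  obtain ⟨φ, hφc, hφ⟩ := exists_monoidHom_of_chart_flat hr hP1 ht hX hPu hP
  have hinj := R.exists_injOn_log hr hP1 hP hφ
  obtain ⟨q, hq0, hq⟩ := R.exists_localInverse_log hr hP1 ht hP hφ
  have hqe := eventually_apply_localInverse_eq_exp hφc R.log_exp hinj hq0 hq
    (exists_curve_of_chart_flat hr hP1 ht hX hP hφ)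
  obtain ⟨e, hec, he0, he⟩ := exists_exp_of_local hinj hq0 (hq.mono fun _ h => h.1) hqe
  obtain ⟨h1, h2⟩ := injective_of_exp hφc R.log_exp hinj hec he0 he
  refine ⟨B.RepSpace, inferInstance, inferInstance, inferInstance, φ, h1, hφc, fun g => ?_⟩
  obtain ⟨x, hx⟩ := h2 g
  rw [hx]
  exact pow_eq_zero_of_le (add_one_le_two_pow_mul_add_one N)
    (NormedSpace.exp_sub_one_pow_eq_zero 𝕜 (R.rep_pow x))

/-- `lowerCentralSeries` is indexed from 0, so its term N is 𝔤^(N+1). A monoid homomorphism from a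
group takes invertible values. At N = 0 the truncated N - 1 is harmless, being multiplied by N. -/
theorem corollary2p14 {𝕜 : Type u} [RCLike 𝕜] (N : ℕ) :
    -- Banach-Lie groups (`SimplyConnectedSpace` contains path connectedness)
    (∀ (E : Type v) [NormedAddCommGroup E] [NormedSpace 𝕜 E] [CompleteSpace E]
      (G : Type w) [TopologicalSpace G] [ChartedSpace E G] [Group G] [LieGroup 𝓘(𝕜, E) ∞ G]
      [SimplyConnectedSpace G],
      LieModule.lowerCentralSeries 𝕜 (GroupLieAlgebra 𝓘(𝕜, E) G)
        (GroupLieAlgebra 𝓘(𝕜, E) G) N = ⊥ →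
      ∃ (F : Type (max u v)) (_ : NormedAddCommGroup F) (_ : NormedSpace 𝕜 F)
        (_ : CompleteSpace F) (ρ : G →* (F →L[𝕜] F)),
        Function.Injective ρ ∧ Continuous ρ ∧
        ∀ x : G, (ρ x - 1) ^ (2 ^ (N - 1) * N + 1) = 0) ∧
    -- Banach-Lie algebras
    (∀ (L : Type v) [NormedLieRing L] [NormedLieAlgebra 𝕜 L] [CompleteSpace L],
      LieModule.lowerCentralSeries 𝕜 L L N = ⊥ →
      ∃ (F : Type (max u v)) (_ : NormedAddCommGroup F) (_ : NormedSpace 𝕜 F)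
        (_ : CompleteSpace F) (ρ : L →L[𝕜] (F →L[𝕜] F)),
        (∀ x y : L, ρ ⁅x, y⁆ = ρ x * ρ y - ρ y * ρ x) ∧ Function.Injective ρ ∧
        ∀ x : L, (ρ x) ^ (2 ^ (N - 1) * N + 1) = 0) := by
  refine ⟨?_, ?_⟩
  · intro E _ _ _ G _ _ _ _ _ hN
    exact exists_faithful_monoidHom_of_lowerCentralSeries_eq_bot N E G hN
  · intro L _ _ _ hN
    exact exists_faithful_rep_of_lowerCentralSeries_eq_bot N L hN
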